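/- Let $(\mathcal X,d,m)$ be a metric measure space (with $m$ Borel) in which all bounded closed sets are compact, and assume that it is Ahlfors $n$-regular for some $n>0$: there is $C>0$ with $C^{-1}r^n\le m(B(x,r))\le C r^n$ for all $x\in\mathcal X$ and $0<r<\operatorname{diam}\mathcal X$. Let $d_w\ge 2$ and let $Z_t$ be a conservative diffusion process on $\mathcal X$ (a time-homogeneous Markov process with continuous paths and infinite lifetime) which has, for every $t>0$, a nonnegative, symmetric transition density $T^Z_t(x,y)$ with respect to $m$, continuous in $(x,y)$, and such that for some constants $c_1,c_2,c_3,c_4>0$ and $t_0\in(0,\infty]$, with $t_0=\infty$ if $\mathcal X$ is unbounded, $$\frac{c_1}{t^{n/d_w}}\exp\Bigl(-c_2\Bigl(\frac{d(x,y)^{d_w}}{t}\Bigr)^{1/(d_w-1)}\Bigr)\le T^Z_t(x,y)\le\frac{c_3}{t^{n/d_w}}\exp\Bigl(-c_4\Bigl(\frac{d(x,y)^{d_w}}{t}\Bigr)^{1/(d_w-1)}\Bigr)$$ for all $x,y\in\mathcal X$ and $t\in(0,t_0)$. Let $\alpha\in(0,d_w)$, let $\eta_t$ be an $\alpha/d_w$-stable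 subordinator independent of $Z$, normalized by $\mathbb E e^{-\lambda\eta_t}=e^{-t\lambda^{\alpha/d_w}}$ for $\lambda\ge0$, and let $X_t=Z(\eta_t)$. Write $T_tf(x)=\mathbb E_xf(X_t)$. Let $\mathcal A f=\lim_{t\downarrow0}(T_tf-f)/t$, with domain $\mathcal D(\mathcal A)$ consisting of all $f\in C_0(\mathcal X)$ for which this limit exists uniformly on $\mathcal X$. Then $T_t$ is symmetric, $\int f\,T_tg\,dm=\int (T_tf)\,g\,dm$ for $f,g\in C_c(\mathcal X)$ (so that $X_t$ is its own dual with respect to $m$), and there is a linear subspace $\mathcal D\subset\mathcal D(\mathcal A)$ with the following properties. 1. (Urysohn bump functions.) For every compact $K$ and open $D$ with $K\subset D\subset\mathcal X$ there is $f\in\mathcal D$ such that $f=1$ on $K$, $f=0$ on $\mathcal X\setminus D$, $0\le f\le1$ on $\mathcal X$, and the boundary of the set $\{x:f(x)>0\}$ has $m$-measure zero. 2. ($\alpha$-stable scaling.) Let $\varrho(K,D)=\inf_f\sup_{x\in\mathcal X}\mathcal Af(x)$, the infimum being taken over all functions $f$ as in 1. There are functions $c(\cdot)$ and $c(\cdot,\cdot,\cdot)$,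 which do not depend on $x_0$ or the radii, such that for all $x_0\in\mathcal X$ $$\varrho\bigl(\overline B(x_0,r),B(x_0,R)\bigr)\le c(r/R)\,R^{-\alpha}\quad\text{whenever }0<r<R,$$ $$\varrho\bigl(\overline A(x_0,p,R),A(x_0,r,\tilde r)\bigr)\le c(r/R,p/R,R/\tilde r)\,R^{-\alpha}\quad\text{whenever }0<r<p<R<\tilde r.$$ Here $B(x_0,r)=\{x:d(x_0,x)<r\}$, $\overline B(x_0,r)=\{x:d(x_0,x)\le r\}$, $A(x_0,r,R)=\{x:r<d(x_0,x)<R\}$ and $\overline A(x_0,r,R)=\{x:r\le d(x_0,x)\le R\}$. -/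

import Mathlib

open MeasureTheory ProbabilityTheory Filter Topology
open scoped NNReal ENNReal ZeroAtInfty

/-! ### The space -/

/-- Ahlfors regularity of dimension `n`: `m(B(x,r))` is comparable to `r ^ n` for all radii
`0 < r < diam X` (so for all `r > 0` when `X` is unbounded). -/
def IsAhlforsRegular {X : Type*} [MetricSpace X] [MeasurableSpace X] (m : Measure X) (n : ℝ) :
    Prop :=
  ∃ c : ℝ, 0 < c ∧ ∀ (x : X) (r : ℝ), 0 < r →
    ENNReal.ofReal r < Metric.ediam (Set.univ : Set X) →
      ENNReal.ofReal (c⁻¹ * r ^ n) ≤ m (Metric.ball x r) ∧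
        m (Metric.ball x r) ≤ ENNReal.ofReal (c * r ^ n)

/-- The closed annulus `{x : r ≤ d(x₀,x) ≤ R}`. -/
def closedAnnulus {X : Type*} [MetricSpace X] (x₀ : X) (r R : ℝ) : Set X :=
  {x | r ≤ dist x₀ x ∧ dist x₀ x ≤ R}

/-- The open annulus `{x : r < d(x₀,x) < R}`. -/
def openAnnulus {X : Type*} [MetricSpace X] (x₀ : X) (r R : ℝ) : Set X :=
  {x | r < dist x₀ x ∧ dist x₀ x < R}

/-! ### Diffusions and subordinators -/

/-- `Z` is a (conservative) diffusion process on `X`, `P x` being the law of the process started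
at `x`: all paths are continuous, `Z 0 = x` almost surely under `P x`, and the (time-homogeneous)
Markov property `P_x(Z_{s+t} ∈ B | σ(Z_u : u ≤ s)) = P_{Z_s}(Z_t ∈ B)` holds. The lifetime is
infinite, as `Z` takes its values in `X` at all times. -/
structure IsDiffusion {X Ω : Type*} [MetricSpace X] [MeasurableSpace X] [MeasurableSpace Ω]
    (P : Kernel X Ω) (Z : ℝ≥0 → Ω → X) : Prop where
  isMarkovKernel : IsMarkovKernel P
  measurable : ∀ t, Measurable (Z t)
  continuous_paths : ∀ ω, Continuous fun t => Z t ω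
  start : ∀ x, ∀ᵐ ω ∂(P x), Z 0 ω = x
  markov : ∀ (x : X) (s t : ℝ≥0) (B : Set X), MeasurableSet B →
    (P x)[(Z (s + t) ⁻¹' B).indicator (fun _ => (1 : ℝ)) |
        ⨆ u ∈ Set.Iic s, MeasurableSpace.comap (Z u) inferInstance]
      =ᵐ[P x] fun ω => (P (Z s ω)).real (Z t ⁻¹' B)

/-- `p` is a symmetric, continuous transition density (with respect to `m`) of the process `Z`,
and it satisfies the two-sided sub-Gaussian bounds with walk dimension `dw` for all times
`t ∈ (0, t₀)`, where `t₀ = ∞` if `X` is unbounded. -/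
structure IsSubGaussianDensity {X Ω : Type*} [MetricSpace X] [MeasurableSpace X]
    [MeasurableSpace Ω] (m : Measure X) (P : Kernel X Ω) (Z : ℝ≥0 → Ω → X) (n dw : ℝ)
    (p : ℝ≥0 → X → X → ℝ) : Prop where
  density : ∀ t : ℝ≥0, 0 < t → ∀ x : X,
    (P x).map (Z t) = m.withDensity fun y => ENNReal.ofReal (p t x y)
  nonneg : ∀ t : ℝ≥0, 0 < t → ∀ x y : X, 0 ≤ p t x y
  symm : ∀ t : ℝ≥0, 0 < t → ∀ x y : X, p t x y = p t y x
  continuous : ∀ t : ℝ≥0, 0 < t → Continuous fun z : X × X => p t z.1 z.2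
  bounds : ∃ (c₁ c₂ c₃ c₄ : ℝ) (t₀ : ℝ≥0∞), 0 < c₁ ∧ 0 < c₂ ∧ 0 < c₃ ∧ 0 < c₄ ∧ 0 < t₀ ∧
    (¬ Bornology.IsBounded (Set.univ : Set X) → t₀ = ⊤) ∧
    ∀ t : ℝ≥0, 0 < t → (t : ℝ≥0∞) < t₀ → ∀ x y : X,
      c₁ / (t : ℝ) ^ (n / dw) * Real.exp (-c₂ * (dist x y ^ dw / (t : ℝ)) ^ (1 / (dw - 1)))
          ≤ p t x y ∧
        p t x y ≤
          c₃ / (t : ℝ) ^ (n / dw) * Real.exp (-c₄ * (dist x y ^ dw / (t : ℝ)) ^ (1 / (dw - 1)))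

/-- `η` is the `β`-stable subordinator: a process in `[0, ∞)` started at `0`, with nondecreasing
right-continuous paths and independent stationary increments, whose Laplace exponent is `λ ^ β`,
that is, `E exp (-λ (η_{s+t} - η_s)) = exp (-t λ ^ β)`. -/
structure IsStableSubordinator {Ω' : Type*} [MeasurableSpace Ω'] (Q : Measure Ω') (β : ℝ)
    (η : ℝ≥0 → Ω' → ℝ≥0) : Prop where
  measurable : ∀ t, Measurable (η t)
  start : ∀ᵐ ω ∂Q, η 0 ω = 0
  monotone_paths : ∀ᵐ ω ∂Q, Monotone fun t => η t ω
  rightContinuous_paths : ∀ᵐ ω ∂Q, ∀ t, ContinuousWithinAt (fun s => η s ω) (Set.Ici t) t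
  indepIncrements : HasIndepIncrements (fun t ω => (η t ω : ℝ)) Q
  laplace : ∀ (s t lam : ℝ≥0),
    ∫ ω, Real.exp (-(lam : ℝ) * ((η (s + t) ω : ℝ) - (η s ω : ℝ))) ∂Q
      = Real.exp (-(t : ℝ) * (lam : ℝ) ^ β)

/-- The subordinate process `X_t = Z(η_t)`, on the product of the probability space of `Z` and that
of `η`, so that `Z` and `η` are independent. Its law from `x` is taken under `(P x).prod Q`. -/
def subordinate {X Ω Ω' : Type*} (Z : ℝ≥0 → Ω → X) (η : ℝ≥0 → Ω' → ℝ≥0) :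
    ℝ≥0 → Ω × Ω' → X :=
  fun t w => Z (η t w.2) w.1

/-! ### Transition operators and generators -/

/-- Transition operators `T_t f(x) = E_x f(Y_t)` of a process `Y`, with law `P x` when it starts
at `x`. -/
noncomputable def transitionOp {X Ω : Type*} [MeasurableSpace Ω] (P : X → Measure Ω)
    (Y : ℝ≥0 → Ω → X) (t : ℝ≥0) (f : X → ℝ) (x : X) : ℝ :=
  ∫ ω, f (Y t ω) ∂(P x)

/-- The operators `T_t` are symmetric with respect to `m`. -/
def IsSymmetricOp {X : Type*} [TopologicalSpace X] [MeasurableSpace X] (m : Measure X)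
    (T : ℝ≥0 → (X → ℝ) → X → ℝ) : Prop :=
  ∀ (t : ℝ≥0) (f g : X → ℝ), Continuous f → HasCompactSupport f → Continuous g →
    HasCompactSupport g → ∫ x, f x * T t g x ∂m = ∫ x, T t f x * g x ∂m

/-- `f ∈ C₀(X)` is in the domain of the Feller generator of `T`: `(T_t f - f) / t` converges
uniformly on `X` as `t ↓ 0`. -/
def InGeneratorDomain {X : Type*} [TopologicalSpace X] (T : ℝ≥0 → (X → ℝ) → X → ℝ)
    (f : C₀(X, ℝ)) : Prop :=
  ∃ g : X → ℝ, TendstoUniformly (fun (t : ℝ≥0) x => (T t f x - f x) / (t : ℝ)) g (𝓝[>] 0)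

/-- The generator `A f(x) = lim_{t ↓ 0} (T_t f(x) - f(x)) / t`, used for `f` in the domain only. -/
noncomputable def generator {X : Type*} (T : ℝ≥0 → (X → ℝ) → X → ℝ) (f : X → ℝ) (x : X) : ℝ :=
  limUnder (𝓝[>] (0 : ℝ≥0)) fun t => (T t f x - f x) / (t : ℝ)

/-! ### Urysohn regularity -/

/-- `f` is a bump function for `K` and `D`. -/
structure IsBump {X : Type*} [TopologicalSpace X] [MeasurableSpace X] (m : Measure X)
    (K D : Set X) (f : X → ℝ) : Prop where
  eq_one : ∀ x ∈ K, f x = 1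
  eq_zero : ∀ x, x ∉ D → f x = 0
  nonneg : ∀ x, 0 ≤ f x
  le_one : ∀ x, f x ≤ 1
  null_frontier : m (frontier {x | 0 < f x}) = 0

/-- The Urysohn regularity hypothesis for the transition operators `T` and their dual `T'`, realized
by the linear space `𝒟`: it consists of functions in the domains of both generators, and contains a
bump function for each compact `K` and open `D` with `K ⊆ D`. -/
def IsUrysohnSpace {X : Type*} [TopologicalSpace X] [MeasurableSpace X] (m : Measure X)
    (T T' : ℝ≥0 → (X → ℝ) → X → ℝ) (𝒟 : Submodule ℝ C₀(X, ℝ)) : Prop :=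
  (∀ f ∈ 𝒟, InGeneratorDomain T f ∧ InGeneratorDomain T' f) ∧
    ∀ K D : Set X, IsCompact K → IsOpen D → K ⊆ D → ∃ f ∈ 𝒟, IsBump m K D f

/-- `ϱ(K, D) = inf_f sup_x max (A f(x), A' f(x))`, the infimum being over the bump functions
`f ∈ 𝒟` for `K` and `D`; infimum and supremum are taken in the extended reals. -/
noncomputable def urysohnRho {X : Type*} [TopologicalSpace X] [MeasurableSpace X] (m : Measure X)
    (T T' : ℝ≥0 → (X → ℝ) → X → ℝ) (𝒟 : Submodule ℝ C₀(X, ℝ)) (K D : Set X) : EReal :=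
  ⨅ (f : C₀(X, ℝ)) (_ : f ∈ 𝒟) (_ : IsBump m K D f),
    ⨆ x : X, ((max (generator T f x) (generator T' f x) : ℝ) : EReal)

/-- `α`-stable scaling of `ϱ`, at all scales, for balls and for annuli. -/
def HasStableScaling {X : Type*} [MetricSpace X] [MeasurableSpace X] (m : Measure X)
    (T T' : ℝ≥0 → (X → ℝ) → X → ℝ) (𝒟 : Submodule ℝ C₀(X, ℝ)) (α : ℝ) : Prop :=
  (∃ c : ℝ → ℝ, ∀ (x₀ : X) (r R : ℝ), 0 < r → r < R →
    urysohnRho m T T' 𝒟 (Metric.closedBall x₀ r) (Metric.ball x₀ R)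
      ≤ ((c (r / R) * R ^ (-α) : ℝ) : EReal)) ∧
  ∃ c : ℝ → ℝ → ℝ → ℝ, ∀ (x₀ : X) (r p R r' : ℝ), 0 < r → r < p → p < R → R < r' →
    urysohnRho m T T' 𝒟 (closedAnnulus x₀ p R) (openAnnulus x₀ r r')
      ≤ ((c (r / R) (p / R) (R / r') * R ^ (-α) : ℝ) : EReal)

/-!
Write `S_t` for the semigroup of the diffusion `Z` and `β = α / dw`. The subordinate semigroup is
`T_t f = E S_{η_t} f`, so its symmetry is inherited from the density of `S_t`. The space `𝒟`
consists of the Lipschitz vectors of `S`, that is, of the `f ∈ C₀` with `‖S_s f - f‖ ≤ L s`.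

*Generator.* For `f ∈ 𝒟` and fixed `x`, the function `h(s) = S_s f(x) - f(x)` is bounded, Lipschitz
and vanishes at `0`, so `|h(u + v) - h(u) - h(v)|` is at most of order `min 1 (min u v)`, hence of
order `u ^ κ v ^ κ` for `κ ≤ 1 / 2`. Since `η` has stationary independent increments and
`E η_t ^ κ` is of order `t ^ (κ / β)` for `κ < β`, the function `a(t) = E h(η_t)` is additive up to
an error `(s t) ^ (κ / β)`. As `κ / β > 1 / 2` can be arranged, `a(t) / t` converges, with a rate
that depends on `f` through `L` and `‖f‖` only, which is uniform convergence in `x`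
(`exists_linear_approx_of_almost_additive`, `IsStableSubordinator.exists_tendsto_rate`). Neither the
Lévy measure nor the density of `η` is needed. The inequality `min 1 (L s) ≤ 2 (1 - exp (-L s))` and
the Laplace transform of `η_t` bound the limit by `2 L ^ β` if `0 ≤ f ≤ 1`
(`IsDiffusion.abs_generator_le`).

*Bump functions.* It remains to find a bump function for a set and its `δ`-neighbourhood that is
Lipschitz in time with constant `L` of order `δ ^ (-dw)`, since then `L ^ β` is of order `δ ^ (-α)`.
Starting with an indicator function, one alternately smooths by a double time average `A_t A_t` of
the semigroup, and resets the function to its values `1` and `0` on slightly shrinking regions. The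
first average makes `S_s - 1` of size `s / t`, the second one makes `(S_s - 1) (S_v - 1)` of size
`s v / t ^ 2`. The sub-Gaussian bounds make the effect of the resetting a power of
`t / (margin) ^ dw` that is as high as desired
(`IsSubGaussianDensity.exists_hasTailBound`), so with `t_{k+1}` proportional to `t_k ^ 3` and
geometric margins all errors are summable (`IsDiffusion.exists_lipschitz_bump`). Continuity of the
limit comes from the strong Feller property. A convex combination of such functions over an
exhaustion of `{φ < ρ}`, where `φ` is the distance to the set and `ρ` a radius with
`m {φ = ρ} = 0`, is positive exactly on `{φ < ρ}`, whose boundary is a null set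
(`IsSubGaussianDensity.exists_isBump_thickening`).
-/

/-! ### Almost additive functions -/

/-- An additive function on `[0, ∞)` of at most linear growth is linear. -/
theorem eq_mul_of_additive_of_abs_le {B : ℝ≥0 → ℝ} {M : ℝ} (hadd : ∀ s t, B (s + t) = B s + B t)
    (hM : ∀ t, |B t| ≤ M * t) (t : ℝ≥0) : B t = B 1 * t := by
  have hnat : ∀ (k : ℕ) (s : ℝ≥0), B (k * s) = k * B s := by
    intro k s
    induction k with
    | zero => simpa using hM 0
    | succ k ih => push_cast; rw [add_mul, one_mul, hadd, ih]; ring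
  have hM0 : 0 ≤ M := by simpa using (abs_nonneg _).trans (hM 1)
  have key : ∀ k : ℕ, 0 < k → |B t - B 1 * t| ≤ 2 * M / k := by
    intro k hk
    have hkR : (0 : ℝ) < k := by exact_mod_cast hk
    set j := ⌊(k : ℝ≥0) * t⌋₊
    have hj : (j : ℝ≥0) ≤ k * t := Nat.floor_le zero_le
    have hj' : (k : ℝ≥0) * t ≤ j + 1 := (Nat.lt_floor_add_one _).le
    obtain ⟨r, hr⟩ := exists_add_of_le hj
    have hr1 : (r : ℝ) ≤ 1 := by
      rw [hr] at hj'
      exact_mod_cast (add_le_add_iff_left _).1 hj'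
    have h1 : (k : ℝ) * B t = j * B 1 + B r := by
      rw [← hnat, hr, hadd, ← hnat, mul_one]
    have h2 : (k : ℝ) * t = j + r := by exact_mod_cast congrArg NNReal.toReal hr
    have h3 : (k : ℝ) * (B t - B 1 * t) = B r - B 1 * r := by
      linear_combination h1 - B 1 * h2
    have h4 : |B r - B 1 * r| ≤ 2 * M := by
      have e1 := hM r
      have e2 : |B 1 * r| ≤ M * r := by
        rw [abs_mul, abs_of_nonneg r.coe_nonneg]
        exact mul_le_mul_of_nonneg_right (by simpa using hM 1) r.coe_nonneg
      have e3 : M * r ≤ M := mul_le_of_le_one_right hM0 hr1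
      calc |B r - B 1 * r| ≤ |B r| + |B 1 * r| := abs_sub _ _
        _ ≤ 2 * M := by linarith
    rw [le_div_iff₀ hkR, mul_comm, ← abs_of_pos hkR, ← abs_mul, h3]
    simpa [abs_of_pos hkR] using h4
  have hlim : Tendsto (fun k : ℕ => 2 * M / (k : ℝ)) atTop (𝓝 0) :=
    tendsto_const_div_atTop_nhds_zero_nat _
  have h0 : |B t - B 1 * t| ≤ 0 :=
    ge_of_tendsto hlim (eventually_atTop.2 ⟨1, fun k hk => key k hk⟩)
  exact sub_eq_zero.1 (abs_nonpos_iff.1 h0)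

/-- A function on `[0, ∞)` that is additive up to an error `A (st) ^ θ` with `2 θ > 1` is linear up
to an error of order `t ^ (2θ)`, with a constant that depends on `A` and `θ` only. -/
theorem exists_linear_approx_of_almost_additive {a : ℝ≥0 → ℝ} {A M θ : ℝ} (hθ : 1 / 2 < θ)
    (ha : ∀ s t : ℝ≥0, |a (s + t) - a s - a t| ≤ A * ((s : ℝ) * t) ^ θ)
    (hM : ∀ t, |a t| ≤ M * t) :
    ∃ b : ℝ, |b| ≤ M ∧
      ∀ t : ℝ≥0, |a t - b * t| ≤ A * 4⁻¹ ^ θ / (1 - 2 * 4⁻¹ ^ θ) * ((t : ℝ) ^ 2) ^ θ := by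
  have hθ0 : 0 < θ := by linarith
  set q : ℝ := 4⁻¹ ^ θ with hq
  have hq0 : 0 < q := by positivity
  have hq1 : 2 * q < 1 := by
    have : q < 4⁻¹ ^ (1 / 2 : ℝ) :=
      Real.rpow_lt_rpow_of_exponent_gt (by norm_num) (by norm_num) hθ
    have h2 : (4⁻¹ : ℝ) ^ (1 / 2 : ℝ) = 2⁻¹ := by
      rw [← Real.sqrt_eq_rpow, show (4⁻¹ : ℝ) = 2⁻¹ ^ 2 by norm_num, Real.sqrt_sq (by norm_num)]
    linarith
  have hA : 0 ≤ A := by simpa using (abs_nonneg _).trans (ha 1 1)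
  set b : ℝ≥0 → ℕ → ℝ := fun t k => 2 ^ k * a (t / 2 ^ k) with hb
  have hqpow : ∀ k : ℕ, ((4⁻¹ : ℝ) ^ k) ^ θ = q ^ k := fun k => by
    rw [hq, ← Real.rpow_natCast, ← Real.rpow_natCast, ← Real.rpow_mul (by norm_num),
      ← Real.rpow_mul (by norm_num), mul_comm]
  have hstep : ∀ t k, dist (b t k) (b t (k + 1)) ≤ A * q * ((t : ℝ) ^ 2) ^ θ * (2 * q) ^ k := by
    intro t k
    have e : t / 2 ^ k = t / 2 ^ (k + 1) + t / 2 ^ (k + 1) := by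
      rw [pow_succ, ← div_div]; exact (add_halves _).symm
    have h1 := ha (t / 2 ^ (k + 1)) (t / 2 ^ (k + 1))
    rw [← e] at h1
    have h2 : (((t / 2 ^ (k + 1) : ℝ≥0) : ℝ) * (t / 2 ^ (k + 1) : ℝ≥0)) ^ θ
        = ((t : ℝ) ^ 2) ^ θ * q ^ (k + 1) := by
      rw [← hqpow, ← Real.mul_rpow (by positivity) (by positivity)]
      congr 1
      push_cast
      rw [show (4⁻¹ : ℝ) = 2⁻¹ * 2⁻¹ by norm_num, mul_pow, div_eq_mul_inv, inv_pow]
      ring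
    rw [h2] at h1
    have h3 : b t k - b t (k + 1) = 2 ^ k * (a (t / 2 ^ k) - a (t / 2 ^ (k + 1))
        - a (t / 2 ^ (k + 1))) := by simp only [hb]; ring
    rw [Real.dist_eq, h3, abs_mul, abs_of_pos (by positivity : (0 : ℝ) < 2 ^ k)]
    calc (2 : ℝ) ^ k * _ ≤ 2 ^ k * (A * (((t : ℝ) ^ 2) ^ θ * q ^ (k + 1))) := by gcongr
      _ = _ := by rw [mul_pow]; ring
  have hex : ∀ t, ∃ l, Tendsto (b t) atTop (𝓝 l) := fun t =>
    cauchySeq_tendsto_of_complete (cauchySeq_of_le_geometric _ _ hq1 (hstep t))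
  choose B hB using hex
  have hBM : ∀ t, |B t| ≤ M * t := by
    intro t
    refine le_of_tendsto (hB t).abs (Eventually.of_forall fun k => ?_)
    have := hM (t / 2 ^ k)
    simp only [hb]
    rw [abs_mul, abs_of_pos (by positivity : (0 : ℝ) < 2 ^ k)]
    calc (2 : ℝ) ^ k * |a (t / 2 ^ k)| ≤ 2 ^ k * (M * (t / 2 ^ k : ℝ≥0)) := by gcongr
      _ = M * t := by push_cast; field_simp
  have hBadd : ∀ s t, B (s + t) = B s + B t := by
    intro s t
    have h1 : Tendsto (fun k => |b (s + t) k - b s k - b t k|) atTop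
        (𝓝 |B (s + t) - B s - B t|) := (((hB _).sub (hB _)).sub (hB _)).abs
    have h2 : Tendsto (fun k : ℕ => A * ((s : ℝ) * t) ^ θ * (2 * q) ^ k) atTop (𝓝 0) := by
      simpa using (tendsto_pow_atTop_nhds_zero_of_lt_one (by positivity) hq1).const_mul
        (A * ((s : ℝ) * t) ^ θ)
    have h3 : |B (s + t) - B s - B t| ≤ 0 := by
      refine le_of_tendsto_of_tendsto' h1 h2 fun k => ?_
      have e := ha (s / 2 ^ k) (t / 2 ^ k)
      rw [← add_div] at e
      have h2 : (((s / 2 ^ k : ℝ≥0) : ℝ) * (t / 2 ^ k : ℝ≥0)) ^ θ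
          = ((s : ℝ) * t) ^ θ * q ^ k := by
        rw [← hqpow, ← Real.mul_rpow (by positivity) (by positivity)]
        congr 1
        push_cast
        rw [show (4⁻¹ : ℝ) = 2⁻¹ * 2⁻¹ by norm_num, mul_pow, inv_pow]
        ring
      rw [h2] at e
      have h3 : b (s + t) k - b s k - b t k = 2 ^ k * (a ((s + t) / 2 ^ k) - a (s / 2 ^ k)
          - a (t / 2 ^ k)) := by simp only [hb]; ring
      rw [h3, abs_mul, abs_of_pos (by positivity : (0 : ℝ) < 2 ^ k)]
      calc (2 : ℝ) ^ k * _ ≤ 2 ^ k * (A * (((s : ℝ) * t) ^ θ * q ^ k)) := by gcongr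
        _ = _ := by rw [mul_pow]; ring
    have := abs_nonpos_iff.1 h3
    linarith
  refine ⟨B 1, by simpa using hBM 1, fun t => ?_⟩
  rw [← eq_mul_of_additive_of_abs_le hBadd hBM t]
  have h := dist_le_of_le_geometric_of_tendsto₀ _ _ hq1 (hstep t) (hB t)
  simp only [hb, pow_zero, one_mul, div_one, Real.dist_eq] at h
  calc _ ≤ _ := h
    _ = _ := by ring

/-! ### Laplace transforms -/

/-- Finite measures on a Polish space are equal if all moments of one injective bounded continuous
function agree. -/
theorem MeasureTheory.Measure.ext_of_moments_eq {E : Type*} [TopologicalSpace E] [PolishSpace E]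
    [MeasurableSpace E] [BorelSpace E] {μ ν : Measure E} [IsFiniteMeasure μ] [IsFiniteMeasure ν]
    (e : BoundedContinuousFunction E ℝ) (he : Function.Injective e)
    (h : ∀ k : ℕ, ∫ x, e x ^ k ∂μ = ∫ x, e x ^ k ∂ν) : μ = ν := by
  let A : StarSubalgebra ℝ (BoundedContinuousFunction E ℝ) :=
    { toSubalgebra := Algebra.adjoin ℝ {e}
      star_mem' := by
        intro a ha
        have : star a = a := by ext; simp
        rwa [this] }
  refine ext_of_forall_mem_subalgebra_integral_eq_of_polish (A := A) ?_ ?_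
  · intro x y hxy
    refine ⟨e, ⟨e.toContinuousMap, ?_, rfl⟩, fun hh => hxy (he hh)⟩
    exact ⟨e, Algebra.subset_adjoin rfl, rfl⟩
  · intro g hg
    have hg' : g ∈ Algebra.adjoin ℝ {e} := hg
    rw [Algebra.adjoin_singleton_eq_range_aeval] at hg'
    obtain ⟨p, rfl⟩ := hg'
    have hval : ∀ x, ((Polynomial.aeval e).toRingHom p : BoundedContinuousFunction E ℝ) x
        = ∑ i ∈ Finset.range (p.natDegree + 1), p.coeff i * e x ^ i := by
      intro x
      change (Polynomial.aeval e p) x = _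
      rw [Polynomial.aeval_eq_sum_range, BoundedContinuousFunction.sum_apply]
      rfl
    have hint : ∀ (ρ : Measure E) [IsFiniteMeasure ρ] (i : ℕ),
        Integrable (fun x => p.coeff i * e x ^ i) ρ :=
      fun ρ _ i => ((e ^ i).integrable ρ).const_mul _
    simp_rw [hval]
    rw [integral_finsetSum _ fun i _ => hint μ i, integral_finsetSum _ fun i _ => hint ν i]
    simp_rw [integral_const_mul, h]

/-- Laplace transforms separate finite measures on `[0, ∞)`. -/
theorem MeasureTheory.Measure.ext_of_laplace_eq {μ ν : Measure ℝ≥0} [IsFiniteMeasure μ]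
    [IsFiniteMeasure ν]
    (h : ∀ l : ℝ≥0, ∫ x : ℝ≥0, Real.exp (-(l : ℝ) * x) ∂μ = ∫ x : ℝ≥0, Real.exp (-(l : ℝ) * x) ∂ν) :
    μ = ν := by
  let e : BoundedContinuousFunction ℝ≥0 ℝ :=
    BoundedContinuousFunction.ofNormedAddCommGroup (fun x : ℝ≥0 => Real.exp (-(x : ℝ)))
      (by fun_prop) 1 (fun x => by simp)
  refine Measure.ext_of_moments_eq e ?_ ?_
  · intro x y hxy
    have : Real.exp (-(x : ℝ)) = Real.exp (-(y : ℝ)) := hxy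
    exact_mod_cast neg_injective (Real.exp_injective this)
  · intro k
    have : ∀ x : ℝ≥0, e x ^ k = Real.exp (-((k : ℝ≥0) : ℝ) * x) := by
      intro x
      change Real.exp (-(x : ℝ)) ^ k = _
      rw [← Real.exp_nat_mul]
      congr 1
      push_cast
      ring
    simp_rw [this]
    exact h k

/-! ### Fractional moments of stable laws -/

/-- A dyadic decomposition of `z ^ κ` into functions whose expectation is a value of the Laplace
transform. -/
theorem ofReal_rpow_le_tsum {κ : ℝ} (hκ : 0 < κ) (z : ℝ≥0) :
    ENNReal.ofReal ((z : ℝ) ^ κ) ≤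
      1 + ∑' j : ℕ, ENNReal.ofReal (2 * 2 ^ κ * (2 ^ κ) ^ j *
        (1 - Real.exp (-((2⁻¹ ^ j : ℝ≥0) : ℝ) * z))) := by
  rcases le_total z 1 with hz | hz
  · refine le_trans ?_ le_self_add
    rw [ENNReal.ofReal_le_one]
    exact Real.rpow_le_one z.coe_nonneg (by exact_mod_cast hz) hκ.le
  · obtain ⟨j, hj1, hj2⟩ := exists_nat_pow_near (x := (z : ℝ)) (y := 2) (by exact_mod_cast hz)
      (by norm_num)
    refine le_trans ?_ (le_add_of_nonneg_left zero_le)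
    refine le_trans ?_ (ENNReal.le_tsum j)
    apply ENNReal.ofReal_le_ofReal
    have h1 : (z : ℝ) ^ κ ≤ 2 ^ κ * (2 ^ κ) ^ j := by
      calc (z : ℝ) ^ κ ≤ ((2 : ℝ) ^ (j + 1)) ^ κ := by gcongr
        _ = _ := by
          rw [← Real.rpow_natCast, ← Real.rpow_mul (by norm_num), mul_comm, Real.rpow_mul
            (by norm_num), Real.rpow_natCast, pow_succ, mul_comm]
    have h2 : Real.exp (-((2⁻¹ ^ j : ℝ≥0) : ℝ) * z) ≤ 1 / 2 := by
      have e1 : (1 : ℝ) ≤ ((2⁻¹ ^ j : ℝ≥0) : ℝ) * z := by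
        push_cast
        rw [inv_pow, inv_mul_eq_div, one_le_div (by positivity)]
        exact hj1
      calc Real.exp (-((2⁻¹ ^ j : ℝ≥0) : ℝ) * z) ≤ Real.exp (-1) := by
            apply Real.exp_le_exp.2; linarith
        _ ≤ 1 / 2 := by
          rw [Real.exp_neg, one_div]
          apply inv_anti₀ (by norm_num)
          linarith [Real.add_one_le_exp (1 : ℝ)]
    have h3 : (0 : ℝ) ≤ 2 ^ κ * (2 ^ κ) ^ j := by positivity
    nlinarith

/-- A random variable with Laplace transform `exp (-l ^ β)` has moments of all orders `κ < β`. -/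
theorem lintegral_rpow_le_of_laplace {Ω' : Type*} [MeasurableSpace Ω'] {Q : Measure Ω'}
    [IsProbabilityMeasure Q] {β κ : ℝ} (hκ : 0 < κ) (hκβ : κ < β) {ζ : Ω' → ℝ≥0}
    (hζ : Measurable ζ)
    (hL : ∀ l : ℝ≥0, ∫ ω, Real.exp (-(l : ℝ) * ζ ω) ∂Q = Real.exp (-(l : ℝ) ^ β)) :
    ∫⁻ ω, ENNReal.ofReal ((ζ ω : ℝ) ^ κ) ∂Q ≤
      ENNReal.ofReal (1 + 2 * 2 ^ κ * (1 - 2 ^ (κ - β))⁻¹) := by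
  have hm : ∀ j : ℕ, Measurable fun ω => ENNReal.ofReal (2 * 2 ^ κ * (2 ^ κ) ^ j *
        (1 - Real.exp (-((2⁻¹ ^ j : ℝ≥0) : ℝ) * ζ ω))) := by
    intro j; fun_prop
  have hr0 : (0 : ℝ) < 2 ^ (κ - β) := by positivity
  have hr1 : (2 : ℝ) ^ (κ - β) < 1 := Real.rpow_lt_one_of_one_lt_of_neg (by norm_num) (by linarith)
  have hterm : ∀ j : ℕ, ∫⁻ ω, ENNReal.ofReal (2 * 2 ^ κ * (2 ^ κ) ^ j *
        (1 - Real.exp (-((2⁻¹ ^ j : ℝ≥0) : ℝ) * ζ ω))) ∂Q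
        ≤ ENNReal.ofReal (2 * 2 ^ κ * (2 ^ (κ - β)) ^ j) := by
    intro j
    have hexp : ∀ ω, Real.exp (-((2⁻¹ ^ j : ℝ≥0) : ℝ) * ζ ω) ≤ 1 := fun ω => by
      apply Real.exp_le_one_iff.2
      rw [neg_mul, neg_nonpos]; positivity
    have hexpint : Integrable (fun ω => Real.exp (-((2⁻¹ ^ j : ℝ≥0) : ℝ) * ζ ω)) Q := by
      refine Integrable.of_bound (by fun_prop) 1 (Eventually.of_forall fun ω => ?_)
      rw [Real.norm_eq_abs, Real.abs_exp]; exact hexp ω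
    rw [← ofReal_integral_eq_lintegral_ofReal]
    · apply ENNReal.ofReal_le_ofReal
      rw [integral_const_mul, integral_sub (integrable_const _) hexpint, hL]
      simp only [integral_const, probReal_univ, smul_eq_mul, mul_one]
      have e1 : 1 - Real.exp (-((2⁻¹ ^ j : ℝ≥0) : ℝ) ^ β) ≤ ((2 : ℝ) ^ (-β)) ^ j := by
        have : (((2⁻¹ ^ j : ℝ≥0) : ℝ)) ^ β = ((2 : ℝ) ^ (-β)) ^ j := by
          push_cast
          rw [inv_pow, ← Real.rpow_natCast, ← Real.rpow_neg (by norm_num),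
            ← Real.rpow_mul (by norm_num), ← Real.rpow_natCast, ← Real.rpow_mul (by norm_num)]
          congr 1; ring
        rw [this]
        linarith [Real.add_one_le_exp (-(((2 : ℝ) ^ (-β)) ^ j))]
      calc _ ≤ 2 * 2 ^ κ * (2 ^ κ) ^ j * ((2 : ℝ) ^ (-β)) ^ j := by gcongr
        _ = _ := by
          rw [mul_assoc, ← mul_pow, ← Real.rpow_add (by norm_num), sub_eq_add_neg]
    · exact ((integrable_const _).sub hexpint).const_mul _
    · refine Eventually.of_forall fun ω => ?_
      exact mul_nonneg (by positivity) (sub_nonneg.2 (hexp ω))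
  calc ∫⁻ ω, ENNReal.ofReal ((ζ ω : ℝ) ^ κ) ∂Q
      ≤ ∫⁻ ω, 1 + ∑' j : ℕ, ENNReal.ofReal (2 * 2 ^ κ * (2 ^ κ) ^ j *
        (1 - Real.exp (-((2⁻¹ ^ j : ℝ≥0) : ℝ) * ζ ω))) ∂Q :=
        lintegral_mono fun ω => ofReal_rpow_le_tsum hκ (ζ ω)
    _ = 1 + ∑' j : ℕ, ∫⁻ ω, ENNReal.ofReal (2 * 2 ^ κ * (2 ^ κ) ^ j *
        (1 - Real.exp (-((2⁻¹ ^ j : ℝ≥0) : ℝ) * ζ ω))) ∂Q := by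
        rw [lintegral_add_left measurable_const, lintegral_tsum fun j => (hm j).aemeasurable]
        simp
    _ ≤ 1 + ∑' j : ℕ, ENNReal.ofReal (2 * 2 ^ κ * (2 ^ (κ - β)) ^ j) := by
        gcongr with j; exact hterm j
    _ = _ := by
        rw [← ENNReal.ofReal_tsum_of_nonneg (fun j => by positivity)
          ((summable_geometric_of_lt_one hr0.le hr1).mul_left _), tsum_mul_left,
          tsum_geometric_of_lt_one hr0.le hr1, ENNReal.ofReal_add (by norm_num), ENNReal.ofReal_one]
        exact mul_nonneg (by positivity) (inv_nonneg.2 (by linarith))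

/-- Moments of order `κ < β` of a random variable with Laplace transform `exp (-t l ^ β)` scale
like `t ^ (κ / β)`. -/
theorem integrable_rpow_and_integral_le_of_laplace {Ω' : Type*} [MeasurableSpace Ω']
    {Q : Measure Ω'} [IsProbabilityMeasure Q] {β κ : ℝ} (hβ : 0 < β) (hκ : 0 < κ) (hκβ : κ < β)
    {t : ℝ≥0} (ht : 0 < t) {ξ : Ω' → ℝ≥0} (hξ : Measurable ξ)
    (hL : ∀ l : ℝ≥0, ∫ ω, Real.exp (-(l : ℝ) * ξ ω) ∂Q = Real.exp (-(t : ℝ) * (l : ℝ) ^ β)) :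
    Integrable (fun ω => (ξ ω : ℝ) ^ κ) Q ∧
      ∫ ω, (ξ ω : ℝ) ^ κ ∂Q ≤ (1 + 2 * 2 ^ κ * (1 - 2 ^ (κ - β))⁻¹) * (t : ℝ) ^ (κ / β) := by
  set c : ℝ≥0 := t ^ (1 / β) with hc
  have hc0 : 0 < c := NNReal.rpow_pos ht
  have hcβ : (c : ℝ) ^ β = t := by
    rw [hc]; push_cast
    rw [← Real.rpow_mul t.coe_nonneg, one_div_mul_cancel hβ.ne', Real.rpow_one]
  have hcκ : (c : ℝ) ^ κ = (t : ℝ) ^ (κ / β) := by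
    rw [hc]; push_cast
    rw [← Real.rpow_mul t.coe_nonneg]; congr 1; ring
  have ht0 : (0 : ℝ) < t := by exact_mod_cast ht
  have hc0' : (0 : ℝ) < c := by exact_mod_cast hc0
  have key := lintegral_rpow_le_of_laplace (Q := Q) hκ hκβ (ζ := fun ω => c⁻¹ * ξ ω)
    (by fun_prop) (fun l => by
      have := hL (l * c⁻¹)
      push_cast at this ⊢
      rw [Real.mul_rpow l.coe_nonneg (by positivity), Real.inv_rpow c.coe_nonneg, hcβ] at this
      rw [show -(t : ℝ) * ((l : ℝ) ^ β * (t : ℝ)⁻¹) = -(l : ℝ) ^ β by field_simp] at this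
      rw [← this]
      simp only [neg_mul, mul_assoc])
  have hr1 : (2 : ℝ) ^ (κ - β) < 1 := Real.rpow_lt_one_of_one_lt_of_neg (by norm_num) (by linarith)
  have hC : (0 : ℝ) ≤ 1 + 2 * 2 ^ κ * (1 - 2 ^ (κ - β))⁻¹ := by
    have : (0 : ℝ) ≤ (1 - 2 ^ (κ - β))⁻¹ := inv_nonneg.2 (by linarith)
    positivity
  have hscale : ∀ ω, (ξ ω : ℝ) ^ κ = (t : ℝ) ^ (κ / β) * ((c⁻¹ * ξ ω : ℝ≥0) : ℝ) ^ κ := by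
    intro ω
    rw [← hcκ, ← Real.mul_rpow hc0'.le (by positivity)]
    push_cast
    rw [mul_inv_cancel_left₀ hc0'.ne']
  have hint : Integrable (fun ω => ((c⁻¹ * ξ ω : ℝ≥0) : ℝ) ^ κ) Q := by
    refine ⟨(Measurable.pow_const (by fun_prop) κ).aestronglyMeasurable, ?_⟩
    rw [hasFiniteIntegral_iff_ofReal (Eventually.of_forall fun ω => by positivity)]
    exact lt_of_le_of_lt key ENNReal.ofReal_lt_top
  simp_rw [hscale]
  refine ⟨hint.const_mul _, ?_⟩
  rw [integral_const_mul, mul_comm]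
  gcongr
  rw [integral_eq_lintegral_of_nonneg_ae (Eventually.of_forall fun ω => by positivity)
    hint.aestronglyMeasurable]
  exact ENNReal.toReal_le_of_le_ofReal hC key

/-! ### Small-time behaviour of the stable subordinator -/

namespace IsStableSubordinator

variable {Ω' : Type*} [MeasurableSpace Ω'] {Q : Measure Ω'} {β : ℝ} {η : ℝ≥0 → Ω' → ℝ≥0}

theorem laplace_eval (hη : IsStableSubordinator Q β η) (t l : ℝ≥0) :
    ∫ ω, Real.exp (-(l : ℝ) * η t ω) ∂Q = Real.exp (-(t : ℝ) * (l : ℝ) ^ β) := by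
  rw [← hη.laplace 0 t l]
  refine integral_congr_ae ?_
  filter_upwards [hη.start] with ω hω
  simp [hω]

theorem laplace_increment (hη : IsStableSubordinator Q β η) (s t l : ℝ≥0) :
    ∫ ω, Real.exp (-(l : ℝ) * (η (s + t) ω - η s ω : ℝ≥0)) ∂Q
      = Real.exp (-(t : ℝ) * (l : ℝ) ^ β) := by
  rw [← hη.laplace s t l]
  refine integral_congr_ae ?_
  filter_upwards [hη.monotone_paths] with ω hω
  rw [NNReal.coe_sub (hω le_self_add)]

/-- The increments are stationary. -/
theorem map_increment [IsProbabilityMeasure Q] (hη : IsStableSubordinator Q β η) (s t : ℝ≥0) :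
    Q.map (fun ω => η (s + t) ω - η s ω) = Q.map (η t) := by
  have hm := hη.measurable
  have h1 : Measurable fun ω => η (s + t) ω - η s ω := (hm _).sub (hm _)
  have := Measure.isProbabilityMeasure_map (μ := Q) h1.aemeasurable
  have := Measure.isProbabilityMeasure_map (μ := Q) (hm t).aemeasurable
  refine Measure.ext_of_laplace_eq fun l => ?_
  rw [integral_map h1.aemeasurable (by fun_prop), integral_map (hm t).aemeasurable (by fun_prop),
    hη.laplace_increment, hη.laplace_eval]

theorem indepFun_increment (hη : IsStableSubordinator Q β η) (s t : ℝ≥0) :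
    IndepFun (fun ω => (η s ω : ℝ)) (fun ω => ((η (s + t) ω - η s ω : ℝ≥0) : ℝ)) Q := by
  have h := hη.indepIncrements.indepFun_sub_sub (r := 0) (s := s) (t := s + t) zero_le
    le_self_add
  refine h.congr ?_ ?_
  · filter_upwards [hη.start] with ω hω
    simp [hω]
  · filter_upwards [hη.monotone_paths] with ω hω
    simp [NNReal.coe_sub (hω le_self_add)]

/-- If `|h s| ≤ min 1 (L s)`, then `|E h (η_t)| ≤ 2 t L ^ β`. -/
theorem abs_integral_le [IsProbabilityMeasure Q] (hη : IsStableSubordinator Q β η) {h : ℝ≥0 → ℝ}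
    {L : ℝ≥0} (h1 : ∀ s, |h s| ≤ 1) (hL : ∀ s, |h s| ≤ L * s) (t : ℝ≥0) :
    |∫ ω, h (η t ω) ∂Q| ≤ 2 * (L : ℝ) ^ β * t := by
  have hexp : ∀ ω, Real.exp (-(L : ℝ) * η t ω) ≤ 1 := fun ω => by
    apply Real.exp_le_one_iff.2
    rw [neg_mul, neg_nonpos]; positivity
  have hm := hη.measurable t
  have hexpint : Integrable (fun ω => Real.exp (-(L : ℝ) * η t ω)) Q := by
    refine Integrable.of_bound (by fun_prop) 1 (Eventually.of_forall fun ω => ?_)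
    rw [Real.norm_eq_abs, Real.abs_exp]; exact hexp ω
  have hpt : ∀ ω, ‖h (η t ω)‖ ≤ 2 * (1 - Real.exp (-(L : ℝ) * η t ω)) := by
    intro ω
    rw [Real.norm_eq_abs]
    have e1 := h1 (η t ω)
    have e2 := hL (η t ω)
    rw [neg_mul]
    set x : ℝ := L * η t ω with hx
    have hx0 : 0 ≤ x := by positivity
    rcases le_total x 1 with h | h
    · have : Real.exp (-x) ≤ 1 - x / 2 := by
        rw [Real.exp_neg, inv_le_comm₀ (Real.exp_pos _) (by linarith)]
        refine le_trans ?_ (Real.add_one_le_exp x)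
        rw [inv_le_iff_one_le_mul₀ (by linarith)]
        nlinarith
      linarith
    · have : Real.exp (-x) ≤ 1 / 2 := by
        rw [Real.exp_neg, one_div]
        exact inv_anti₀ (by norm_num) (by linarith [Real.add_one_le_exp x])
      linarith
  calc |∫ ω, h (η t ω) ∂Q| ≤ ∫ ω, 2 * (1 - Real.exp (-(L : ℝ) * η t ω)) ∂Q :=
        norm_integral_le_of_norm_le (((integrable_const _).sub hexpint).const_mul _)
          (Eventually.of_forall hpt)
    _ = 2 * (1 - Real.exp (-(t : ℝ) * (L : ℝ) ^ β)) := by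
        rw [integral_const_mul, integral_sub (integrable_const _) hexpint, hη.laplace_eval]
        simp
    _ ≤ 2 * (L : ℝ) ^ β * t := by
        have := Real.add_one_le_exp (-(t : ℝ) * (L : ℝ) ^ β)
        linarith

/-- For bounded Lipschitz `h` with `h 0 = 0` the function `t ↦ E h (η_t)` is almost additive:
`h (u + v) - h u - h v` is of order `min u v`, hence at most a multiple of `u ^ κ v ^ κ` when
`2 κ ≤ 1`, and `η_{s+t}` is the sum of independent copies of `η_s` and `η_t`. -/
theorem abs_integral_add_sub_le [IsProbabilityMeasure Q] (hβ : 0 < β)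
    (hη : IsStableSubordinator Q β η) {κ : ℝ} (hκ : 0 < κ) (hκβ : κ < β) (hκ2 : 2 * κ ≤ 1)
    {h : ℝ≥0 → ℝ} {L : ℝ≥0} (h1 : ∀ s, |h s| ≤ 1) (h0 : h 0 = 0)
    (hL : ∀ s t, |h (s + t) - h s| ≤ L * t) (hh : Measurable h) (s t : ℝ≥0) :
    |∫ ω, h (η (s + t) ω) ∂Q - ∫ ω, h (η s ω) ∂Q - ∫ ω, h (η t ω) ∂Q| ≤
      (3 + 2 * L) * (1 + 2 * 2 ^ κ * (1 - 2 ^ (κ - β))⁻¹) ^ 2 * ((s : ℝ) * t) ^ (κ / β) := by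
  have hm := hη.measurable
  have hr1 : (2 : ℝ) ^ (κ - β) < 1 := Real.rpow_lt_one_of_one_lt_of_neg (by norm_num) (by linarith)
  set C : ℝ := 1 + 2 * 2 ^ κ * (1 - 2 ^ (κ - β))⁻¹ with hC
  have hC0 : 0 ≤ C := by
    have : (0 : ℝ) ≤ (1 - 2 ^ (κ - β))⁻¹ := inv_nonneg.2 (by linarith)
    positivity
  have hzero : ∫ ω, h (η 0 ω) ∂Q = 0 := by
    rw [integral_congr_ae (g := fun _ => 0) ?_, integral_zero]
    filter_upwards [hη.start] with ω hω
    simp [hω, h0]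
  rcases eq_or_lt_of_le (zero_le : 0 ≤ s) with rfl | hs
  · simp only [zero_add, hzero, sub_zero, sub_self, abs_zero]
    positivity
  rcases eq_or_lt_of_le (zero_le : 0 ≤ t) with rfl | ht
  · simp only [add_zero, hzero, sub_self, abs_zero]
    positivity
  set ξ : Ω' → ℝ≥0 := fun ω => η (s + t) ω - η s ω with hξ
  have hξm : Measurable ξ := (hm _).sub (hm _)
  have hbint : ∀ {ζ : Ω' → ℝ≥0}, Measurable ζ → Integrable (fun ω => h (ζ ω)) Q := fun hζ =>
    Integrable.of_bound (hh.comp hζ).aestronglyMeasurable 1 (Eventually.of_forall fun ω => h1 _)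
  have hlaw : ∫ ω, h (η t ω) ∂Q = ∫ ω, h (ξ ω) ∂Q := by
    rw [← integral_map (hm t).aemeasurable hh.aestronglyMeasurable, ← hη.map_increment s t,
      integral_map hξm.aemeasurable hh.aestronglyMeasurable]
  obtain ⟨i1, b1⟩ := integrable_rpow_and_integral_le_of_laplace hβ hκ hκβ hs (hm s)
    (hη.laplace_eval s)
  obtain ⟨i2, b2⟩ := integrable_rpow_and_integral_le_of_laplace hβ hκ hκβ ht hξm
    (hη.laplace_increment s t)
  have hind : IndepFun (fun ω => (η s ω : ℝ) ^ κ) (fun ω => (ξ ω : ℝ) ^ κ) Q :=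
    (hη.indepFun_increment s t).comp (φ := fun x : ℝ => x ^ κ) (ψ := fun x : ℝ => x ^ κ)
      (Measurable.pow_const measurable_id κ) (Measurable.pow_const measurable_id κ)
  have hprod := hind.integral_fun_mul_eq_mul_integral i1.aestronglyMeasurable
    i2.aestronglyMeasurable
  have hprodint : Integrable (fun ω => (η s ω : ℝ) ^ κ * (ξ ω : ℝ) ^ κ) Q :=
    hind.integrable_mul i1 i2
  -- `|h (u + v) - h u - h v| ≤ 3` and `≤ 2 L min u v`
  have hpt : ∀ u v : ℝ≥0, |h (u + v) - h u - h v| ≤ (3 + 2 * L) * ((u : ℝ) ^ κ * (v : ℝ) ^ κ) := by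
    have hb : ∀ v, |h v| ≤ L * v := fun v => by simpa [h0] using hL 0 v
    have main : ∀ u v : ℝ≥0, v ≤ u →
        |h (u + v) - h u - h v| ≤ (3 + 2 * L) * ((u : ℝ) ^ κ * (v : ℝ) ^ κ) := by
      intro u v hvu
      have hvu' : (v : ℝ) ≤ u := by exact_mod_cast hvu
      rcases le_total (v : ℝ) 1 with hv | hv
      · have e1 : |h (u + v) - h u - h v| ≤ 2 * L * v := by
          calc _ ≤ |h (u + v) - h u| + |h v| := abs_sub _ _
            _ ≤ 2 * L * v := by linarith [hL u v, hb v]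
        have e2 : (v : ℝ) ≤ (u : ℝ) ^ κ * (v : ℝ) ^ κ := by
          calc (v : ℝ) = (v : ℝ) ^ (1 : ℝ) := (Real.rpow_one _).symm
            _ ≤ (v : ℝ) ^ (2 * κ) :=
              Real.rpow_le_rpow_of_exponent_ge' v.coe_nonneg hv (by positivity) hκ2
            _ = (v : ℝ) ^ κ * (v : ℝ) ^ κ := by
              rw [two_mul, Real.rpow_add_of_nonneg v.coe_nonneg hκ.le hκ.le]
            _ ≤ _ := by gcongr
        calc _ ≤ 2 * (L : ℝ) * v := e1
          _ ≤ 2 * L * ((u : ℝ) ^ κ * (v : ℝ) ^ κ) := by gcongr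
          _ ≤ _ := by gcongr; linarith
      · have e1 : |h (u + v) - h u - h v| ≤ 3 := by
          calc _ ≤ |h (u + v) - h u| + |h v| := abs_sub _ _
            _ ≤ |h (u + v)| + |h u| + |h v| := by gcongr; exact abs_sub _ _
            _ ≤ 3 := by linarith [h1 (u + v), h1 u, h1 v]
        have e2 : 1 ≤ (u : ℝ) ^ κ * (v : ℝ) ^ κ :=
          one_le_mul_of_one_le_of_one_le (Real.one_le_rpow (hv.trans hvu') hκ.le)
            (Real.one_le_rpow hv hκ.le)
        have : (0 : ℝ) ≤ 2 * L := by positivity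
        nlinarith
    intro u v
    rcases le_total v u with hvu | hvu
    · exact main u v hvu
    · have := main v u hvu
      rw [add_comm u v, mul_comm ((u : ℝ) ^ κ)]
      convert this using 2
      ring
  have hadd : ∀ᵐ ω ∂Q, h (η (s + t) ω) = h (η s ω + ξ ω) := by
    filter_upwards [hη.monotone_paths] with ω hω
    rw [hξ, add_tsub_cancel_of_le (hω le_self_add)]
  have hsum : Integrable (fun ω => h (η s ω + ξ ω)) Q := hbint ((hm s).add hξm)
  have hdiff : Integrable (fun ω => h (η s ω + ξ ω) - h (η s ω)) Q := hsum.sub (hbint (hm s))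
  rw [hlaw, integral_congr_ae hadd, ← integral_sub hsum (hbint (hm s)),
    ← integral_sub hdiff (hbint hξm)]
  calc |∫ ω, h (η s ω + ξ ω) - h (η s ω) - h (ξ ω) ∂Q|
      ≤ ∫ ω, (3 + 2 * L) * ((η s ω : ℝ) ^ κ * (ξ ω : ℝ) ^ κ) ∂Q :=
        norm_integral_le_of_norm_le (f := fun ω => h (η s ω + ξ ω) - h (η s ω) - h (ξ ω))
          (hprodint.const_mul _) (Eventually.of_forall fun ω => hpt _ _)
    _ = (3 + 2 * L) * ((∫ ω, (η s ω : ℝ) ^ κ ∂Q) * ∫ ω, (ξ ω : ℝ) ^ κ ∂Q) := by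
        rw [integral_const_mul, hprod]
    _ ≤ (3 + 2 * L) * ((C * (s : ℝ) ^ (κ / β)) * (C * (t : ℝ) ^ (κ / β))) := by
        have : 0 ≤ ∫ ω, (ξ ω : ℝ) ^ κ ∂Q := integral_nonneg fun ω => by positivity
        gcongr
    _ = _ := by
        rw [Real.mul_rpow s.coe_nonneg t.coe_nonneg]; ring

/-- For bounded Lipschitz functions `h` with `h 0 = 0` the limit of `E h (η_t) / t` as `t ↓ 0`
exists, with a rate which depends on the Lipschitz constant of `h` only. -/
theorem exists_tendsto_rate [IsProbabilityMeasure Q] (hβ : 0 < β) (hβ1 : β < 1)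
    (hη : IsStableSubordinator Q β η) (L : ℝ≥0) :
    ∃ A ρ : ℝ, 0 < ρ ∧ ∀ h : ℝ≥0 → ℝ, Measurable h → (∀ s, |h s| ≤ 1) → h 0 = 0 →
      (∀ s t, |h (s + t) - h s| ≤ L * t) →
      ∃ b : ℝ, |b| ≤ 2 * (L : ℝ) ^ β ∧
        ∀ t : ℝ≥0, 0 < t → |(∫ ω, h (η t ω) ∂Q) / t - b| ≤ A * (t : ℝ) ^ ρ := by
  -- any order in `(β / 2, β)` that does not exceed `1 / 2` will do
  set κ : ℝ := β / 2 + β * (1 - β) / 4 with hκdef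
  have hb1 : 0 < β * (1 - β) := mul_pos hβ (by linarith)
  have hκ : 0 < κ := by positivity
  have hκβ : κ < β := by nlinarith
  have hκ2 : 2 * κ ≤ 1 := by nlinarith
  have hθ : 1 / 2 < κ / β := by rw [lt_div_iff₀ hβ]; linarith
  refine ⟨(3 + 2 * L) * (1 + 2 * 2 ^ κ * (1 - 2 ^ (κ - β))⁻¹) ^ 2 * 4⁻¹ ^ (κ / β) /
    (1 - 2 * 4⁻¹ ^ (κ / β)), 2 * (κ / β) - 1, by linarith, fun h hh h1 h0 hL => ?_⟩
  have hb : ∀ v, |h v| ≤ L * v := fun v => by simpa [h0] using hL 0 v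
  obtain ⟨b, hbM, hb⟩ := exists_linear_approx_of_almost_additive hθ
    (a := fun t => ∫ ω, h (η t ω) ∂Q) (hη.abs_integral_add_sub_le hβ hκ hκβ hκ2 h1 h0 hL hh)
    (hη.abs_integral_le h1 hb)
  refine ⟨b, hbM, fun t ht => ?_⟩
  have ht0 : (0 : ℝ) < t := by exact_mod_cast ht
  have e : (∫ ω, h (η t ω) ∂Q) / t - b = (∫ ω, h (η t ω) ∂Q - b * t) / t := by field_simp
  rw [e, abs_div, abs_of_pos ht0, div_le_iff₀ ht0, mul_assoc]
  refine (hb t).trans_eq ?_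
  congr 1
  rw [← Real.rpow_add_one ht0.ne', sub_add_cancel, ← Real.rpow_natCast (t : ℝ) 2,
    ← Real.rpow_mul ht0.le]
  norm_num

end IsStableSubordinator

/-! ### The semigroup of a diffusion -/

/-- The transition semigroup `S_t f(x) = E_x f(Z_t)` of `Z`. -/
noncomputable def heat {X Ω : Type*} [MeasurableSpace X] [MeasurableSpace Ω] (P : Kernel X Ω)
    (Z : ℝ≥0 → Ω → X) (t : ℝ≥0) (f : X → ℝ) (x : X) : ℝ :=
  ∫ ω, f (Z t ω) ∂(P x)

/-- The time average `t⁻¹ ∫₀ᵗ S_v f dv` of the semigroup. -/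
noncomputable def heatAvg {X Ω : Type*} [MeasurableSpace X] [MeasurableSpace Ω] (P : Kernel X Ω)
    (Z : ℝ≥0 → Ω → X) (t : ℝ) (f : X → ℝ) (x : X) : ℝ :=
  t⁻¹ * ∫ v in (0 : ℝ)..t, heat P Z v.toNNReal f x

namespace IsDiffusion

variable {X Ω : Type*} [MetricSpace X] [MeasurableSpace X] [MeasurableSpace Ω]
  {P : Kernel X Ω} {Z : ℝ≥0 → Ω → X} {f g : X → ℝ} {B : ℝ}

theorem measurable_uncurry [BorelSpace X] (hZ : IsDiffusion P Z) :
    Measurable fun q : ℝ≥0 × Ω => Z q.1 q.2 :=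
  measurable_uncurry_of_continuous_of_measurable hZ.continuous_paths hZ.measurable

theorem integrable_comp (hZ : IsDiffusion P Z) (hf : Measurable f) (hB : ∀ x, |f x| ≤ B)
    (t : ℝ≥0) (x : X) : Integrable (fun ω => f (Z t ω)) (P x) :=
  have := hZ.isMarkovKernel
  Integrable.of_bound (hf.comp (hZ.measurable t)).aestronglyMeasurable B
    (Eventually.of_forall fun _ => hB _)

theorem measurable_heat_uncurry [BorelSpace X] (hZ : IsDiffusion P Z) (hf : Measurable f) :
    Measurable fun q : ℝ≥0 × X => heat P Z q.1 f q.2 := by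
  have := hZ.isMarkovKernel
  have h : StronglyMeasurable fun r : (ℝ≥0 × X) × Ω => f (Z r.1.1 r.2) :=
    (hf.comp (hZ.measurable_uncurry.comp
      (measurable_fst.fst.prodMk measurable_snd))).stronglyMeasurable
  exact (h.integral_kernel_prod_right' (κ := P.comap Prod.snd measurable_snd)).measurable

theorem measurable_heat [BorelSpace X] (hZ : IsDiffusion P Z) (hf : Measurable f) (t : ℝ≥0) :
    Measurable (heat P Z t f) :=
  (hZ.measurable_heat_uncurry hf).comp (measurable_const.prodMk measurable_id)

theorem abs_heat_le (hZ : IsDiffusion P Z) (hB : ∀ x, |f x| ≤ B) (t : ℝ≥0) (x : X) :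
    |heat P Z t f x| ≤ B := by
  have := hZ.isMarkovKernel
  have h := norm_integral_le_of_norm_le_const (μ := P x) (f := fun ω => f (Z t ω)) (C := B)
    (Eventually.of_forall fun ω => hB _)
  simpa [heat] using h

theorem heat_zero (hZ : IsDiffusion P Z) (f : X → ℝ) (x : X) :
    heat P Z 0 f x = f x := by
  have := hZ.isMarkovKernel
  have : heat P Z 0 f x = ∫ _, f x ∂(P x) := by
    refine integral_congr_ae ?_
    filter_upwards [hZ.start x] with ω hω
    rw [hω]
  simpa using this

theorem heat_sub (hZ : IsDiffusion P Z) (hf : Measurable f) (hB : ∀ x, |f x| ≤ B)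
    (hg : Measurable g) {B' : ℝ} (hB' : ∀ x, |g x| ≤ B') (t : ℝ≥0) (x : X) :
    heat P Z t (fun y => f y - g y) x = heat P Z t f x - heat P Z t g x :=
  integral_sub (hZ.integrable_comp hf hB t x) (hZ.integrable_comp hg hB' t x)

/-- The Chapman–Kolmogorov equation, integrated form of the Markov property. -/
theorem kernel_add (hZ : IsDiffusion P Z) (s t : ℝ≥0) :
    P.map (Z (s + t)) = (P.map (Z t)) ∘ₖ (P.map (Z s)) := by
  have := hZ.isMarkovKernel
  ext x B hB
  rw [Kernel.map_apply' _ (hZ.measurable _) _ hB, Kernel.comp_apply' _ _ _ hB,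
    Kernel.map_apply _ (hZ.measurable s),
    lintegral_map (Kernel.measurable_coe _ hB) (hZ.measurable s)]
  simp_rw [Kernel.map_apply' _ (hZ.measurable t) _ hB]
  have hle : ⨆ u ∈ Set.Iic s, MeasurableSpace.comap (Z u) inferInstance
      ≤ (inferInstance : MeasurableSpace Ω) :=
    iSup₂_le fun u _ => (hZ.measurable u).comap_le
  have h1 := integral_condExp (μ := P x) hle
    (f := (Z (s + t) ⁻¹' B).indicator (fun _ => (1 : ℝ)))
  rw [integral_congr_ae (hZ.markov x s t B hB), integral_indicator (hZ.measurable _ hB)] at h1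
  simp only [integral_const, MeasurableSet.univ, measureReal_restrict_apply, Set.univ_inter,
    smul_eq_mul, mul_one] at h1
  have hmeas : Measurable fun ω => P (Z s ω) (Z t ⁻¹' B) :=
    (Kernel.measurable_coe P (hZ.measurable t hB)).comp (hZ.measurable s)
  simp only [measureReal_def] at h1
  rw [integral_toReal hmeas.aemeasurable (Eventually.of_forall fun ω => measure_lt_top _ _)] at h1
  refine ((ENNReal.toReal_eq_toReal_iff' ?_ (measure_ne_top _ _)).1 h1).symm
  refine ne_top_of_le_ne_top ENNReal.one_ne_top ?_
  calc ∫⁻ ω, P (Z s ω) (Z t ⁻¹' B) ∂(P x) ≤ ∫⁻ _, 1 ∂(P x) := lintegral_mono fun _ => prob_le_one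
    _ = 1 := by simp

theorem heat_add [BorelSpace X] (hZ : IsDiffusion P Z) (hf : Measurable f) (hB : ∀ x, |f x| ≤ B)
    (s t : ℝ≥0) (x : X) : heat P Z (s + t) f x = heat P Z s (heat P Z t f) x := by
  have := hZ.isMarkovKernel
  have hmap : ∀ (u : ℝ≥0) (g : X → ℝ) (_ : Measurable g) (y : X),
      heat P Z u g y = ∫ z, g z ∂(P.map (Z u) y) := by
    intro u g hg y
    rw [Kernel.map_apply _ (hZ.measurable u),
      integral_map (hZ.measurable u).aemeasurable hg.aestronglyMeasurable]
    rfl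
  have hM := Kernel.IsMarkovKernel.map P (hZ.measurable (s + t))
  have hint : Integrable f (P.map (Z (s + t)) x) :=
    Integrable.of_bound hf.aestronglyMeasurable B (Eventually.of_forall hB)
  rw [hmap _ _ hf, hmap _ _ (hZ.measurable_heat hf t)]
  rw [hZ.kernel_add s t] at hint ⊢
  rw [Kernel.integral_comp hint]
  simp_rw [hmap t f hf]

theorem heat_comm [BorelSpace X] (hZ : IsDiffusion P Z) (hf : Measurable f) (hB : ∀ x, |f x| ≤ B)
    (s t : ℝ≥0) (x : X) :
    heat P Z s (heat P Z t f) x = heat P Z t (heat P Z s f) x := by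
  rw [← hZ.heat_add hf hB, add_comm, hZ.heat_add hf hB]

theorem measurable_heat_path [BorelSpace X] (hZ : IsDiffusion P Z) (hf : Measurable f) (x : X) :
    Measurable fun v : ℝ => heat P Z v.toNNReal f x :=
  (hZ.measurable_heat_uncurry hf).comp (measurable_real_toNNReal.prodMk measurable_const)

theorem intervalIntegrable_heat [BorelSpace X] (hZ : IsDiffusion P Z) (hf : Measurable f)
    (hB : ∀ x, |f x| ≤ B) (x : X) (a b : ℝ) :
    IntervalIntegrable (fun v : ℝ => heat P Z v.toNNReal f x) volume a b :=
  (intervalIntegrable_const (c := B)).mono_fun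
    (hZ.measurable_heat_path hf x).aestronglyMeasurable
    (Eventually.of_forall fun v => by
      simpa using (hZ.abs_heat_le hB v.toNNReal x).trans (le_abs_self B))

theorem measurable_heatAvg [BorelSpace X] (hZ : IsDiffusion P Z) (hf : Measurable f) {t : ℝ}
    (ht : 0 < t) : Measurable (heatAvg P Z t f) := by
  have h : StronglyMeasurable fun q : X × ℝ => heat P Z q.2.toNNReal f q.1 :=
    ((hZ.measurable_heat_uncurry hf).comp
      ((measurable_real_toNNReal.comp measurable_snd).prodMk measurable_fst)).stronglyMeasurable
  have h2 := (h.integral_prod_right' (ν := volume.restrict (Set.Ioc 0 t))).measurable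
  unfold heatAvg
  simp_rw [intervalIntegral.integral_of_le ht.le]
  exact h2.const_mul _

/-- If `S_v f(x)` is within `ε` of `c` for all times `v ≤ t`, then so is its time average. -/
theorem abs_heatAvg_sub_le [BorelSpace X] (hZ : IsDiffusion P Z) (hf : Measurable f)
    (hB : ∀ x, |f x| ≤ B) {t : ℝ} (ht : 0 < t) {x : X} {c ε : ℝ}
    (h : ∀ v : ℝ≥0, 0 < v → (v : ℝ) ≤ t → |heat P Z v f x - c| ≤ ε) :
    |heatAvg P Z t f x - c| ≤ ε := by
  have e : heatAvg P Z t f x - c = t⁻¹ * ∫ v in (0 : ℝ)..t, (heat P Z v.toNNReal f x - c) := by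
    rw [intervalIntegral.integral_sub (hZ.intervalIntegrable_heat hf hB x 0 t)
      intervalIntegrable_const, mul_sub, intervalIntegral.integral_const, heatAvg]
    simp [ht.ne']
  have h2 : ‖∫ v in (0 : ℝ)..t, (heat P Z v.toNNReal f x - c)‖ ≤ ε * |t - 0| := by
    refine intervalIntegral.norm_integral_le_of_norm_le_const fun v hv => ?_
    rw [Set.uIoc_of_le ht.le] at hv
    refine h _ (Real.toNNReal_pos.2 hv.1) ?_
    rw [Real.coe_toNNReal _ hv.1.le]
    exact hv.2
  rw [e, abs_mul, abs_of_pos (inv_pos.2 ht), inv_mul_le_iff₀ ht, mul_comm]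
  simpa [abs_of_pos ht] using h2

theorem abs_heatAvg_le [BorelSpace X] (hZ : IsDiffusion P Z) (hf : Measurable f)
    (hB : ∀ x, |f x| ≤ B) {t : ℝ} (ht : 0 < t) (x : X) : |heatAvg P Z t f x| ≤ B := by
  have := hZ.abs_heatAvg_sub_le hf hB ht (x := x) (c := 0) (ε := B)
    (fun v _ _ => by simpa using hZ.abs_heat_le hB v x)
  simpa using this

theorem heatAvg_sub [BorelSpace X] (hZ : IsDiffusion P Z) (hf : Measurable f) (hB : ∀ x, |f x| ≤ B)
    (hg : Measurable g) {B' : ℝ} (hB' : ∀ x, |g x| ≤ B') (t : ℝ) (x : X) :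
    heatAvg P Z t (fun y => f y - g y) x = heatAvg P Z t f x - heatAvg P Z t g x := by
  unfold heatAvg
  simp_rw [hZ.heat_sub hf hB hg hB']
  rw [intervalIntegral.integral_sub (hZ.intervalIntegrable_heat hf hB x 0 t)
    (hZ.intervalIntegrable_heat hg hB' x 0 t), mul_sub]

theorem heat_heatAvg [BorelSpace X] (hZ : IsDiffusion P Z) (hf : Measurable f)
    (hB : ∀ x, |f x| ≤ B) (s : ℝ≥0) {t : ℝ} (ht : 0 < t) (x : X) :
    heat P Z s (heatAvg P Z t f) x = heatAvg P Z t (heat P Z s f) x := by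
  have := hZ.isMarkovKernel
  have hm : Measurable fun q : Ω × ℝ => heat P Z q.2.toNNReal f (Z s q.1) :=
    (hZ.measurable_heat_uncurry hf).comp ((measurable_real_toNNReal.comp measurable_snd).prodMk
      ((hZ.measurable s).comp measurable_fst))
  unfold heatAvg
  simp_rw [intervalIntegral.integral_of_le ht.le]
  rw [heat, integral_const_mul]
  congr 1
  refine (integral_integral_swap (f := fun (ω : Ω) (v : ℝ) => heat P Z v.toNNReal f (Z s ω))
    (ν := volume.restrict (Set.Ioc 0 t)) ?_).trans ?_
  rotate_left
  · refine integral_congr_ae (Eventually.of_forall fun v => ?_)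
    exact hZ.heat_comm hf hB s v.toNNReal x
  · exact Integrable.of_bound hm.aestronglyMeasurable B
      (Eventually.of_forall fun q => hZ.abs_heat_le hB _ _)

/-- Time averages are Lipschitz in time: the integrals of `S_v f` over `[s, t + s]` and `[0, t]`
differ by two integrals over intervals of length `s`. -/
theorem abs_heat_heatAvg_sub_le [BorelSpace X] (hZ : IsDiffusion P Z) (hf : Measurable f)
    (hB : ∀ x, |f x| ≤ B) (s : ℝ≥0) {t : ℝ} (ht : 0 < t) (x : X) :
    |heat P Z s (heatAvg P Z t f) x - heatAvg P Z t f x| ≤ 2 * B * s / t := by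
  rw [hZ.heat_heatAvg hf hB s ht]
  unfold heatAvg
  set F : ℝ → ℝ := fun v => heat P Z v.toNNReal f x with hF
  have hFi : ∀ a b, IntervalIntegrable F volume a b := hZ.intervalIntegrable_heat hf hB x
  have hFb : ∀ v, ‖F v‖ ≤ B := fun v => hZ.abs_heat_le hB _ _
  have e1 : ∫ v in (0 : ℝ)..t, heat P Z v.toNNReal (heat P Z s f) x
      = ∫ v in (s : ℝ)..(t + s), F v := by
    rw [← zero_add (s : ℝ), show t + (0 + s) = t + s by ring,
      ← intervalIntegral.integral_comp_add_right F (s : ℝ)]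
    refine intervalIntegral.integral_congr fun v hv => ?_
    rw [Set.uIcc_of_le ht.le] at hv
    simp only [hF]
    rw [Real.toNNReal_add hv.1 s.coe_nonneg, Real.toNNReal_coe, hZ.heat_add hf hB]
  have e2 : (∫ v in (s : ℝ)..(t + s), F v) - ∫ v in (0 : ℝ)..t, F v
      = (∫ v in t..(t + s), F v) - ∫ v in (0 : ℝ)..s, F v := by
    rw [← intervalIntegral.integral_add_adjacent_intervals (hFi 0 s) (hFi s t) ,
      ← intervalIntegral.integral_add_adjacent_intervals (hFi s t) (hFi t (t + s))]
    ring
  have b1 : ‖∫ v in t..(t + s), F v‖ ≤ B * |t + s - t| :=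
    intervalIntegral.norm_integral_le_of_norm_le_const fun v _ => hFb v
  have b2 : ‖∫ v in (0 : ℝ)..s, F v‖ ≤ B * |(s : ℝ) - 0| :=
    intervalIntegral.norm_integral_le_of_norm_le_const fun v _ => hFb v
  rw [add_sub_cancel_left, abs_of_nonneg s.coe_nonneg] at b1
  rw [sub_zero, abs_of_nonneg s.coe_nonneg] at b2
  rw [e1, ← mul_sub, e2, abs_mul, abs_of_pos (inv_pos.2 ht), inv_mul_eq_div]
  gcongr
  rw [Real.norm_eq_abs] at b1 b2
  exact (abs_sub _ _).trans (by linarith)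

end IsDiffusion

/-! ### The generator of the subordinate process -/

theorem abs_zeroAtInfty_le {X : Type*} [TopologicalSpace X] (f : C₀(X, ℝ)) (x : X) :
    |f x| ≤ ‖f‖ :=
  f.toBCF.norm_coe_le_norm x

section Subordinate

variable {X Ω Ω' : Type*} [MetricSpace X] [MeasurableSpace X] [BorelSpace X] [MeasurableSpace Ω]
  [MeasurableSpace Ω'] {P : Kernel X Ω} {Z : ℝ≥0 → Ω → X} {Q : Measure Ω'}
  [IsProbabilityMeasure Q] {β : ℝ} {η : ℝ≥0 → Ω' → ℝ≥0} {f : X → ℝ}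

/-- The subordinate semigroup is an average of the semigroup of `Z` over the law of `η_t`. -/
theorem IsDiffusion.transitionOp_subordinate (hZ : IsDiffusion P Z) (hη : ∀ t, Measurable (η t))
    (hf : Measurable f) {B : ℝ} (hB : ∀ x, |f x| ≤ B) (t : ℝ≥0) (x : X) :
    transitionOp (fun x => (P x).prod Q) (subordinate Z η) t f x
      = ∫ ω, heat P Z (η t ω) f x ∂Q := by
  have := hZ.isMarkovKernel
  have hm : Measurable fun w : Ω × Ω' => f (Z (η t w.2) w.1) :=
    hf.comp (hZ.measurable_uncurry.comp (((hη t).comp measurable_snd).prodMk measurable_fst))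
  exact integral_prod_symm _ (Integrable.of_bound hm.aestronglyMeasurable B
    (Eventually.of_forall fun _ => hB _))

/-- If `S_s f - f` is bounded by `min B (L s)`, then `f` is in the domain of the generator of the
subordinate process, and the generator is bounded in terms of `B` and `L`. -/
theorem IsDiffusion.exists_generator (hZ : IsDiffusion P Z) (hβ : 0 < β) (hβ1 : β < 1)
    (hη : IsStableSubordinator Q β η) (hf : Measurable f) {C : ℝ} (hC : ∀ x, |f x| ≤ C)
    {B L : ℝ≥0} (hB0 : 0 < B) (hB : ∀ s x, |heat P Z s f x - f x| ≤ B)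
    (hL : ∀ s x, |heat P Z s f x - f x| ≤ L * s) :
    ∃ g : X → ℝ, TendstoUniformly (fun (t : ℝ≥0) x =>
        (transitionOp (fun x => (P x).prod Q) (subordinate Z η) t f x - f x) / (t : ℝ)) g (𝓝[>] 0) ∧
      ∀ x, |g x| ≤ B * (2 * ((L / B : ℝ≥0) : ℝ) ^ β) := by
  obtain ⟨A, ρ, hρ, key⟩ := hη.exists_tendsto_rate hβ hβ1 (L / B)
  have hB0' : (0 : ℝ) < B := by exact_mod_cast hB0
  have hx : ∀ x, ∃ b : ℝ, |b| ≤ 2 * ((L / B : ℝ≥0) : ℝ) ^ β ∧ ∀ t : ℝ≥0, 0 < t →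
      |(∫ ω, (heat P Z (η t ω) f x - f x) / B ∂Q) / t - b| ≤ A * (t : ℝ) ^ ρ := by
    intro x
    refine key (fun s => (heat P Z s f x - f x) / B) ?_ ?_ ?_ ?_
    · exact (((hZ.measurable_heat_uncurry hf).comp
        (measurable_id.prodMk measurable_const)).sub_const _).div_const _
    · intro s
      rw [abs_div, abs_of_pos hB0', div_le_one hB0']
      exact hB s x
    · simp [hZ.heat_zero]
    · intro s t
      rw [← sub_div, sub_sub_sub_cancel_right, hZ.heat_add hf hC,
        ← hZ.heat_sub (hZ.measurable_heat hf t) (hZ.abs_heat_le hC t) hf hC, abs_div,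
        abs_of_pos hB0']
      push_cast
      rw [div_mul_eq_mul_div]
      gcongr
      exact hZ.abs_heat_le (hL t) s x
  choose b hb hbt using hx
  refine ⟨fun x => B * b x, ?_, fun x => ?_⟩
  · rw [Metric.tendstoUniformly_iff]
    intro ε hε
    have hlim : Tendsto (fun t : ℝ≥0 => B * (A * (t : ℝ) ^ ρ)) (𝓝[>] 0) (𝓝 0) := by
      have : Continuous fun t : ℝ≥0 => B * (A * (t : ℝ) ^ ρ) := by
        have := Real.continuous_rpow_const hρ.le
        fun_prop
      have h := (this.tendsto 0).mono_left (nhdsWithin_le_nhds (s := Set.Ioi 0))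
      simpa [Real.zero_rpow hρ.ne'] using h
    filter_upwards [hlim.eventually (gt_mem_nhds hε), self_mem_nhdsWithin] with t ht ht0 x
    refine lt_of_le_of_lt ?_ ht
    have ht1 : (0 : ℝ) < t := by exact_mod_cast (ht0 : 0 < t)
    have hint : Integrable (fun ω => heat P Z (η t ω) f x) Q :=
      Integrable.of_bound (((hZ.measurable_heat_uncurry hf).comp
        ((hη.measurable t).prodMk measurable_const)).aestronglyMeasurable) C
        (Eventually.of_forall fun ω => hZ.abs_heat_le hC _ _)
    have h := hbt x t ht0
    rw [integral_div, integral_sub hint (integrable_const _)] at h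
    simp only [integral_const, probReal_univ, one_smul] at h
    rw [dist_comm, Real.dist_eq, hZ.transitionOp_subordinate hη.measurable hf hC]
    have e : (∫ ω, heat P Z (η t ω) f x ∂Q - f x) / t - B * b x
        = B * ((∫ ω, heat P Z (η t ω) f x ∂Q - f x) / B / t - b x) := by
      field_simp
    rw [e, abs_mul, abs_of_pos hB0']
    gcongr
  · rw [abs_mul, abs_of_pos hB0']
    gcongr
    exact hb x

/-- The Lipschitz vectors of the semigroup of `Z`: functions `f` in `C₀` with
`‖S_s f - f‖ = O(s)`. -/
noncomputable def IsDiffusion.lipschitzSpace (hZ : IsDiffusion P Z) : Submodule ℝ C₀(X, ℝ) where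
  carrier := {f | ∃ L : ℝ≥0, ∀ s x, |heat P Z s f x - f x| ≤ L * s}
  zero_mem' := ⟨0, fun s x => by simp [heat]⟩
  add_mem' := by
    rintro f g ⟨L, hL⟩ ⟨M, hM⟩
    refine ⟨L + M, fun s x => ?_⟩
    have e : heat P Z s (f + g : C₀(X, ℝ)) x = heat P Z s f x + heat P Z s g x :=
      integral_add (hZ.integrable_comp f.continuous.measurable (abs_zeroAtInfty_le f) s x)
        (hZ.integrable_comp g.continuous.measurable (abs_zeroAtInfty_le g) s x)
    rw [e, ZeroAtInftyContinuousMap.add_apply, add_sub_add_comm]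
    push_cast
    rw [add_mul]
    exact (abs_add_le _ _).trans (add_le_add (hL s x) (hM s x))
  smul_mem' := by
    rintro c f ⟨L, hL⟩
    refine ⟨‖c‖₊ * L, fun s x => ?_⟩
    have e : heat P Z s (c • f : C₀(X, ℝ)) x = c * heat P Z s f x := integral_const_mul _ _
    rw [e, ZeroAtInftyContinuousMap.smul_apply, smul_eq_mul, ← mul_sub, abs_mul]
    push_cast
    rw [mul_assoc, Real.norm_eq_abs]
    gcongr
    exact hL s x

theorem IsDiffusion.inGeneratorDomain (hZ : IsDiffusion P Z) (hβ : 0 < β) (hβ1 : β < 1)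
    (hη : IsStableSubordinator Q β η) {f : C₀(X, ℝ)} (hf : f ∈ hZ.lipschitzSpace) :
    InGeneratorDomain (transitionOp (fun x => (P x).prod Q) (subordinate Z η)) f := by
  obtain ⟨L, hL⟩ := hf
  obtain ⟨g, hg, -⟩ := hZ.exists_generator hβ hβ1 hη f.continuous.measurable
    (abs_zeroAtInfty_le f) (B := ‖f‖₊ + ‖f‖₊ + 1) (by positivity) (fun s x => by
      push_cast
      have h1 := hZ.abs_heat_le (abs_zeroAtInfty_le f) s x
      have h2 := abs_zeroAtInfty_le f x
      calc _ ≤ |heat P Z s f x| + |f x| := abs_sub _ _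
        _ ≤ _ := by linarith) hL
  exact ⟨g, hg⟩

theorem IsDiffusion.abs_generator_le (hZ : IsDiffusion P Z) (hβ : 0 < β) (hβ1 : β < 1)
    (hη : IsStableSubordinator Q β η) (hf : Measurable f) (h0 : ∀ x, 0 ≤ f x) (h1 : ∀ x, f x ≤ 1)
    {L : ℝ≥0} (hL : ∀ s x, |heat P Z s f x - f x| ≤ L * s) (x : X) :
    |generator (transitionOp (fun x => (P x).prod Q) (subordinate Z η)) f x|
      ≤ 2 * (L : ℝ) ^ β := by
  have hC : ∀ x, |f x| ≤ 1 := fun x => abs_le.2 ⟨by linarith [h0 x], h1 x⟩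
  have := hZ.isMarkovKernel
  obtain ⟨g, hg, hgb⟩ := hZ.exists_generator hβ hβ1 hη hf hC (B := 1) one_pos (fun s x => by
      have e0 : 0 ≤ heat P Z s f x := integral_nonneg fun ω => h0 _
      have e1 := (abs_le.1 (hZ.abs_heat_le hC s x)).2
      rw [NNReal.coe_one, abs_le]
      constructor <;> linarith [h0 x, h1 x]) hL
  have hx := (hg.tendsto_at x).limUnder_eq
  rw [generator, hx]
  simpa using hgb x

end Subordinate

/-! ### Double time averages -/

/-- The smoothing operator `f ↦ A_t A_t f`, where `A_t` is the time average of the semigroup. One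
average makes first differences in time small, two averages make second differences small. -/
noncomputable def heatSmooth {X Ω : Type*} [MeasurableSpace X] [MeasurableSpace Ω] (P : Kernel X Ω)
    (Z : ℝ≥0 → Ω → X) (t : ℝ) (f : X → ℝ) : X → ℝ :=
  heatAvg P Z t (heatAvg P Z t f)

namespace IsDiffusion

variable {X Ω : Type*} [MetricSpace X] [MeasurableSpace X] [BorelSpace X] [MeasurableSpace Ω]
  {P : Kernel X Ω} {Z : ℝ≥0 → Ω → X} {f g : X → ℝ} {B : ℝ}

theorem measurable_heatSmooth (hZ : IsDiffusion P Z) (hf : Measurable f) {t : ℝ} (ht : 0 < t) :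
    Measurable (heatSmooth P Z t f) :=
  hZ.measurable_heatAvg (hZ.measurable_heatAvg hf ht) ht

theorem abs_heat_heatSmooth_sub_le (hZ : IsDiffusion P Z) (hf : Measurable f)
    (hB : ∀ x, |f x| ≤ B) (s : ℝ≥0) {t : ℝ} (ht : 0 < t) (x : X) :
    |heat P Z s (heatSmooth P Z t f) x - heatSmooth P Z t f x| ≤ 2 * B * s / t :=
  hZ.abs_heat_heatAvg_sub_le (hZ.measurable_heatAvg hf ht) (hZ.abs_heatAvg_le hf hB ht) s ht x

/-- If `S_v f(x)` is within `ε` of `c` for all times `v ≤ 2 t`, then so is `A_t A_t f(x)`. -/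
theorem abs_heatSmooth_sub_le (hZ : IsDiffusion P Z) (hf : Measurable f)
    (hB : ∀ x, |f x| ≤ B) {t : ℝ} (ht : 0 < t) {x : X} {c ε : ℝ}
    (h : ∀ v : ℝ≥0, 0 < v → (v : ℝ) ≤ 2 * t → |heat P Z v f x - c| ≤ ε) :
    |heatSmooth P Z t f x - c| ≤ ε := by
  refine hZ.abs_heatAvg_sub_le (hZ.measurable_heatAvg hf ht) (hZ.abs_heatAvg_le hf hB ht) ht
    fun v hv hvt => ?_
  rw [hZ.heat_heatAvg hf hB v ht]
  refine hZ.abs_heatAvg_sub_le (hZ.measurable_heat hf v) (hZ.abs_heat_le hB v) ht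
    fun u hu hut => ?_
  rw [← hZ.heat_add hf hB]
  refine h _ (add_pos hu hv) ?_
  push_cast
  linarith

theorem abs_heatSmooth_le (hZ : IsDiffusion P Z) (hf : Measurable f)
    (hB : ∀ x, |f x| ≤ B) {t : ℝ} (ht : 0 < t) (x : X) : |heatSmooth P Z t f x| ≤ B :=
  hZ.abs_heatAvg_le (hZ.measurable_heatAvg hf ht) (hZ.abs_heatAvg_le hf hB ht) ht x

theorem heatSmooth_sub (hZ : IsDiffusion P Z) (hf : Measurable f) (hB : ∀ x, |f x| ≤ B)
    (hg : Measurable g) {B' : ℝ} (hB' : ∀ x, |g x| ≤ B') {t : ℝ} (ht : 0 < t) (x : X) :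
    heatSmooth P Z t (fun y => f y - g y) x = heatSmooth P Z t f x - heatSmooth P Z t g x := by
  have e : heatAvg P Z t (fun y => f y - g y)
      = fun y => heatAvg P Z t f y - heatAvg P Z t g y := funext (hZ.heatAvg_sub hf hB hg hB' t)
  rw [heatSmooth, e, hZ.heatAvg_sub (hZ.measurable_heatAvg hf ht) (hZ.abs_heatAvg_le hf hB ht)
    (hZ.measurable_heatAvg hg ht) (hZ.abs_heatAvg_le hg hB' ht)]
  rfl

theorem heat_heatSmooth (hZ : IsDiffusion P Z) (hf : Measurable f)
    (hB : ∀ x, |f x| ≤ B) (s : ℝ≥0) {t : ℝ} (ht : 0 < t) (x : X) :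
    heat P Z s (heatSmooth P Z t f) x = heatSmooth P Z t (heat P Z s f) x := by
  have e : heat P Z s (heatAvg P Z t f) = heatAvg P Z t (heat P Z s f) :=
    funext (hZ.heat_heatAvg hf hB s ht)
  rw [heatSmooth, hZ.heat_heatAvg (hZ.measurable_heatAvg hf ht) (hZ.abs_heatAvg_le hf hB ht) s ht,
    e, heatSmooth]

/-- Bound on second differences in time: with `D_s = S_s - 1`, the function
`D_s D_v A_t A_t f = (D_v A_t) (D_s A_t) f` is of order `s v / t ^ 2`. -/
theorem abs_heat_heatSmooth_heatSmooth_sub_le (hZ : IsDiffusion P Z) (hf : Measurable f)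
    (hB : ∀ x, |f x| ≤ B) (s : ℝ≥0) {t τ : ℝ} (ht : 0 < t) (hτ : 0 < τ) (x : X) :
    |heat P Z s (fun y => heatSmooth P Z τ (heatSmooth P Z t f) y - heatSmooth P Z t f y) x
      - (heatSmooth P Z τ (heatSmooth P Z t f) x - heatSmooth P Z t f x)|
      ≤ 8 * B * s * τ / t ^ 2 := by
  have hB0 : 0 ≤ B := (abs_nonneg _).trans (hB x)
  have hAm := hZ.measurable_heatAvg hf ht
  have hAb := hZ.abs_heatAvg_le hf hB ht
  have hgm := hZ.measurable_heatSmooth hf ht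
  have hgb := hZ.abs_heatSmooth_le hf hB ht
  have hsgm := hZ.measurable_heat hgm s
  have hsgb := hZ.abs_heat_le hgb s
  set g := heatSmooth P Z t f with hg
  set k : X → ℝ := fun y => heat P Z s (heatAvg P Z t f) y - heatAvg P Z t f y with hk
  have hkm : Measurable k := (hZ.measurable_heat hAm s).sub hAm
  have hkb : ∀ y, |k y| ≤ 2 * B * s / t := hZ.abs_heat_heatAvg_sub_le hf hB s ht
  have hdiff : (fun y => heat P Z s g y - g y) = heatAvg P Z t k := by
    funext y
    rw [hk, hZ.heatAvg_sub (hZ.measurable_heat hAm s) (hZ.abs_heat_le hAb s) hAm hAb,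
      ← hZ.heat_heatAvg hAm hAb s ht]
    rfl
  have e : heat P Z s (fun y => heatSmooth P Z τ g y - g y) x - (heatSmooth P Z τ g x - g x)
      = heatSmooth P Z τ (heatAvg P Z t k) x - heatAvg P Z t k x := by
    rw [← hdiff, hZ.heatSmooth_sub hsgm hsgb hgm hgb hτ,
      hZ.heat_sub (hZ.measurable_heatSmooth hgm hτ) (hZ.abs_heatSmooth_le hgm hgb hτ) hgm hgb,
      hZ.heat_heatSmooth hgm hgb s hτ]
    ring
  rw [e]
  refine hZ.abs_heatSmooth_sub_le (hZ.measurable_heatAvg hkm ht) (hZ.abs_heatAvg_le hkm hkb ht) hτ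
    fun v hv hvt => ?_
  refine (hZ.abs_heat_heatAvg_sub_le hkm hkb v ht x).trans ?_
  calc 2 * (2 * B * s / t) * v / t = 4 * B * s * v / t ^ 2 := by field_simp; ring
    _ ≤ 4 * B * s * (2 * τ) / t ^ 2 := by gcongr
    _ = _ := by ring

/-- A function that is constant near `x` is changed at `x` by the semigroup by no more than the
probability to be outside that neighbourhood at the given time. -/
theorem abs_heat_sub_le_of_eq_const (hZ : IsDiffusion P Z) (hf : Measurable f)
    (hf01 : ∀ x, f x ∈ Set.Icc (0 : ℝ) 1) {c : ℝ} (hc : c ∈ Set.Icc (0 : ℝ) 1) {x : X} {d : ℝ}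
    (h : ∀ y, dist x y < d → f y = c) (v : ℝ≥0) :
    |heat P Z v f x - c| ≤ (P x).real {ω | d ≤ dist x (Z v ω)} := by
  have := hZ.isMarkovKernel
  have hS : MeasurableSet {ω | d ≤ dist x (Z v ω)} :=
    measurableSet_le measurable_const ((continuous_const.dist continuous_id).measurable.comp
      (hZ.measurable v))
  have e : heat P Z v f x - c = ∫ ω, (f (Z v ω) - c) ∂(P x) := by
    rw [integral_sub (hZ.integrable_comp hf (B := 1) (fun y => abs_le.2
      ⟨by linarith [(hf01 y).1], (hf01 y).2⟩) v x) (integrable_const _)]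
    simp [heat]
  rw [e, ← Real.norm_eq_abs]
  calc _ ≤ ∫ ω, {ω | d ≤ dist x (Z v ω)}.indicator (fun _ => (1 : ℝ)) ω ∂(P x) := by
        refine norm_integral_le_of_norm_le ((integrable_const _).indicator hS)
          (Eventually.of_forall fun ω => ?_)
        by_cases hω : d ≤ dist x (Z v ω)
        · rw [Set.indicator_of_mem (by exact hω), Real.norm_eq_abs, abs_le]
          constructor <;> linarith [(hf01 (Z v ω)).1, (hf01 (Z v ω)).2, hc.1, hc.2]
        · rw [Set.indicator_of_notMem (by exact hω), h _ (not_le.1 hω)]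
          simp
    _ = _ := by simp [integral_indicator_const _ hS]

end IsDiffusion

/-! ### Bump functions by repeated smoothing and cutting off -/

/-- Summability of `q ^ k 2 ^ (-3 ^ k)`. -/
theorem summable_pow_mul_half_pow_three_pow (q : ℝ) :
    Summable fun k : ℕ => q ^ k * (1 / 2 : ℝ) ^ 3 ^ k := by
  rcases eq_or_ne q 0 with rfl | hq
  · exact summable_of_ne_finset_zero (s := {0}) fun k hk => by
      rw [zero_pow (by simpa using hk), zero_mul]
  refine summable_of_ratio_test_tendsto_lt_one (l := 0) one_pos
    (Eventually.of_forall fun k => by positivity) ?_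
  have h3 : Tendsto (fun k : ℕ => 2 * 3 ^ k) atTop atTop := by
    have : Tendsto (fun k : ℕ => 3 ^ k) atTop atTop :=
      tendsto_pow_atTop_atTop_of_one_lt (by norm_num)
    exact this.const_mul_atTop' (by norm_num)
  have h := ((tendsto_pow_atTop_nhds_zero_of_lt_one (r := (1 / 2 : ℝ)) (by norm_num)
    (by norm_num)).comp h3).const_mul |q|
  rw [mul_zero] at h
  refine h.congr fun k => ?_
  simp only [Function.comp_apply, Real.norm_eq_abs, abs_mul, abs_pow]
  rw [abs_of_pos (by norm_num : (0 : ℝ) < 1 / 2), pow_succ |q|, pow_succ 3 k,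
    show 3 ^ k * 3 = 3 ^ k + 2 * 3 ^ k by ring, pow_add]
  have : |q| ≠ 0 := abs_ne_zero.2 hq
  field_simp

/-- Truncation: `1` where `φ ≤ a`, `0` where `b ≤ φ`, and `g` in between. -/
noncomputable def cutOff {X : Type*} (φ : X → ℝ) (a b : ℝ) (g : X → ℝ) (x : X) : ℝ :=
  if φ x ≤ a then 1 else if b ≤ φ x then 0 else g x

/-- The times `δ ^ dw 2 ^ (-3 ^ k)` of the successive smoothings. Each is (up to scaling) the cube
of the preceding one. -/
noncomputable def bumpTime (dw δ : ℝ) (k : ℕ) : ℝ := δ ^ dw * (1 / 2) ^ 3 ^ k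

/-- The approximations to a bump function. At each step the function is smoothed and then reset to
its values `1` and `0` on the regions `φ ≤ δ / 4 + 2⁻ᵏ δ / 8` and `3 δ / 4 - 2⁻ᵏ δ / 8 ≤ φ`. These
regions shrink with `k`, which leaves room for the next smoothing to change the function only by a
tiny amount near the points where it is reset. -/
noncomputable def bumpSeq {X Ω : Type*} [MeasurableSpace X] [MeasurableSpace Ω] (P : Kernel X Ω)
    (Z : ℝ≥0 → Ω → X) (φ : X → ℝ) (dw δ : ℝ) : ℕ → X → ℝ
  | 0 => cutOff φ (δ * (1 / 4 + (1 / 2) ^ 0 / 8)) (δ * (3 / 4 - (1 / 2) ^ 0 / 8)) 0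
  | k + 1 => cutOff φ (δ * (1 / 4 + (1 / 2) ^ (k + 1) / 8)) (δ * (3 / 4 - (1 / 2) ^ (k + 1) / 8))
      (heatSmooth P Z (bumpTime dw δ k) (bumpSeq P Z φ dw δ k))

theorem measurable_cutOff {X : Type*} [TopologicalSpace X] [MeasurableSpace X]
    [OpensMeasurableSpace X] {φ : X → ℝ} (hφ : Continuous φ) (a b : ℝ) {g : X → ℝ}
    (hg : Measurable g) :
    Measurable (cutOff φ a b g) :=
  Measurable.ite (measurableSet_le hφ.measurable measurable_const) measurable_const
    (Measurable.ite (measurableSet_le measurable_const hφ.measurable) measurable_const hg)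

theorem cutOff_mem_Icc {X : Type*} (φ : X → ℝ) (a b : ℝ) {g : X → ℝ}
    (hg : ∀ x, g x ∈ Set.Icc (0 : ℝ) 1) (x : X) :
    cutOff φ a b g x ∈ Set.Icc (0 : ℝ) 1 := by
  unfold cutOff
  split_ifs
  · simp
  · simp
  · exact hg x

theorem bumpSeq_eq_one {X Ω : Type*} [MeasurableSpace X] [MeasurableSpace Ω] {P : Kernel X Ω}
    {Z : ℝ≥0 → Ω → X} {φ : X → ℝ} {dw δ : ℝ} (k : ℕ) {x : X}
    (hx : φ x ≤ δ * (1 / 4 + (1 / 2) ^ k / 8)) :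
    bumpSeq P Z φ dw δ k x = 1 := by
  cases k <;> exact if_pos hx

theorem bumpSeq_eq_zero {X Ω : Type*} [MeasurableSpace X] [MeasurableSpace Ω] {P : Kernel X Ω}
    {Z : ℝ≥0 → Ω → X} {φ : X → ℝ} {dw δ : ℝ} (hδ : 0 < δ) (k : ℕ) {x : X}
    (hx : δ * (3 / 4 - (1 / 2) ^ k / 8) ≤ φ x) : bumpSeq P Z φ dw δ k x = 0 := by
  have h1 : ((1 : ℝ) / 2) ^ k ≤ 1 := pow_le_one₀ (by norm_num) (by norm_num)
  have h2 : ¬ φ x ≤ δ * (1 / 4 + (1 / 2) ^ k / 8) := by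
    rw [not_le]
    refine lt_of_lt_of_le ?_ hx
    gcongr
    linarith
  cases k <;> exact (if_neg h2).trans (if_pos hx)

theorem bumpTime_pos {dw δ : ℝ} (hδ : 0 < δ) (k : ℕ) : 0 < bumpTime dw δ k := by
  unfold bumpTime; positivity

namespace IsDiffusion

variable {X Ω : Type*} [MetricSpace X] [MeasurableSpace X] [BorelSpace X] [MeasurableSpace Ω]
  {P : Kernel X Ω} {Z : ℝ≥0 → Ω → X} {φ : X → ℝ} {dw δ : ℝ}

theorem heatSmooth_mem_Icc (hZ : IsDiffusion P Z) {f : X → ℝ} (hf : Measurable f)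
    (hf01 : ∀ x, f x ∈ Set.Icc (0 : ℝ) 1) {t : ℝ} (ht : 0 < t) (x : X) :
    heatSmooth P Z t f x ∈ Set.Icc (0 : ℝ) 1 := by
  have := hZ.isMarkovKernel
  have h1 : ∀ y, |f y| ≤ 1 := fun y => abs_le.2 ⟨by linarith [(hf01 y).1], (hf01 y).2⟩
  have h2 : |heatSmooth P Z t f x - 1 / 2| ≤ 1 / 2 := by
    refine hZ.abs_heatSmooth_sub_le hf h1 ht fun v _ _ => ?_
    have e0 : 0 ≤ heat P Z v f x := integral_nonneg fun ω => (hf01 _).1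
    have e1 := (abs_le.1 (hZ.abs_heat_le h1 v x)).2
    rw [abs_le]
    constructor <;> linarith
  rw [abs_le] at h2
  constructor <;> linarith

theorem bumpSeq_measurable_mem_Icc (hZ : IsDiffusion P Z) (hφ : Continuous φ) (hδ : 0 < δ)
    (k : ℕ) : Measurable (bumpSeq P Z φ dw δ k) ∧
      ∀ x, bumpSeq P Z φ dw δ k x ∈ Set.Icc (0 : ℝ) 1 := by
  induction k with
  | zero => exact ⟨measurable_cutOff hφ _ _ measurable_const, cutOff_mem_Icc _ _ _ (by simp)⟩
  | succ k ih =>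
    exact ⟨measurable_cutOff hφ _ _ (hZ.measurable_heatSmooth ih.1 (bumpTime_pos hδ k)),
      cutOff_mem_Icc _ _ _ (hZ.heatSmooth_mem_Icc ih.1 ih.2 (bumpTime_pos hδ k))⟩

end IsDiffusion

/-- Polynomial bound for the probability that `Z` is at distance at least `d` from its starting
point at time `u`. The exponent `4` is chosen to exceed the exponent `3` in the recursion of the smoothing
times of `bumpSeq`. -/
def HasTailBound {X Ω : Type*} [MetricSpace X] [MeasurableSpace X] [MeasurableSpace Ω]
    (P : Kernel X Ω) (Z : ℝ≥0 → Ω → X) (dw C : ℝ) : Prop :=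
  ∀ (u : ℝ≥0) (d : ℝ) (x : X), 0 < u → 0 < d →
    (P x).real {ω | d ≤ dist x (Z u ω)} ≤ C * ((u : ℝ) / d ^ dw) ^ 4

namespace IsDiffusion

variable {X Ω : Type*} [MetricSpace X] [MeasurableSpace X] [BorelSpace X] [MeasurableSpace Ω]
  {P : Kernel X Ω} {Z : ℝ≥0 → Ω → X} {φ : X → ℝ} {dw δ C : ℝ}

/-- Resetting the smoothed function changes it by a super-exponentially small amount only. -/
theorem abs_heatSmooth_bumpSeq_sub_le (hZ : IsDiffusion P Z) (hC0 : 0 ≤ C)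
    (hC : HasTailBound P Z dw C) (hφ : LipschitzWith 1 φ) (hδ : 0 < δ) (k : ℕ) (x : X) :
    |heatSmooth P Z (bumpTime dw δ k) (bumpSeq P Z φ dw δ k) x - bumpSeq P Z φ dw δ (k + 1) x|
      ≤ C * (2 * 16 ^ dw) ^ 4 * ((2 ^ dw) ^ 4) ^ k * ((1 / 2) ^ 3 ^ k) ^ 4 := by
  obtain ⟨hm, h01⟩ := hZ.bumpSeq_measurable_mem_Icc (dw := dw) hφ.continuous hδ k
  have h1 : ∀ y, |bumpSeq P Z φ dw δ k y| ≤ 1 := fun y =>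
    abs_le.2 ⟨by linarith [(h01 y).1], (h01 y).2⟩
  have ht := bumpTime_pos (dw := dw) hδ k
  set d : ℝ := δ * ((1 / 2) ^ k / 16) with hd
  have hd0 : 0 < d := by positivity
  have hdw : d ^ dw = δ ^ dw * ((16 ^ dw)⁻¹ * ((2 ^ dw) ^ k)⁻¹) := by
    rw [hd, Real.mul_rpow hδ.le (by positivity), div_eq_mul_inv, Real.mul_rpow (by positivity)
      (by norm_num), Real.inv_rpow (by norm_num), one_div, inv_pow, Real.inv_rpow (by positivity),
      ← Real.rpow_natCast, ← Real.rpow_mul (by norm_num), ← Real.rpow_natCast,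
      ← Real.rpow_mul (by norm_num), mul_comm dw]
    ring
  have main : ∀ c ∈ Set.Icc (0 : ℝ) 1, (∀ y, dist x y < d → bumpSeq P Z φ dw δ k y = c) →
      |heatSmooth P Z (bumpTime dw δ k) (bumpSeq P Z φ dw δ k) x - c|
      ≤ C * (2 * 16 ^ dw) ^ 4 * ((2 ^ dw) ^ 4) ^ k * ((1 / 2) ^ 3 ^ k) ^ 4 := by
    intro c hc h
    refine hZ.abs_heatSmooth_sub_le hm h1 ht fun v hv hvt => ?_
    refine (hZ.abs_heat_sub_le_of_eq_const hm h01 hc h v).trans ((hC v d x hv hd0).trans ?_)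
    have hle : (v : ℝ) / d ^ dw ≤ 2 * 16 ^ dw * (2 ^ dw) ^ k * (1 / 2) ^ 3 ^ k := by
      rw [hdw, div_le_iff₀ (by positivity)]
      refine hvt.trans_eq ?_
      unfold bumpTime
      have : (0 : ℝ) < 16 ^ dw := by positivity
      have : (0 : ℝ) < 2 ^ dw := by positivity
      field_simp
    calc C * ((v : ℝ) / d ^ dw) ^ 4
        ≤ C * (2 * 16 ^ dw * (2 ^ dw) ^ k * (1 / 2) ^ 3 ^ k) ^ 4 := by gcongr
      _ = _ := by rw [← pow_mul, mul_comm 4 k, pow_mul]; ring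
  have hLip : ∀ y, |φ x - φ y| ≤ dist x y := fun y => by
    simpa [Real.dist_eq] using hφ.dist_le_mul x y
  have hstep : ((1 : ℝ) / 2) ^ (k + 1) = (1 / 2) ^ k / 2 := by rw [pow_succ]; ring
  by_cases hx1 : φ x ≤ δ * (1 / 4 + (1 / 2) ^ (k + 1) / 8)
  · rw [bumpSeq_eq_one _ hx1]
    refine main 1 (by simp) fun y hy => bumpSeq_eq_one k ?_
    have := (abs_le.1 (hLip y)).1
    rw [hstep] at hx1
    linarith
  · by_cases hx2 : δ * (3 / 4 - (1 / 2) ^ (k + 1) / 8) ≤ φ x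
    · rw [bumpSeq_eq_zero hδ _ hx2]
      refine main 0 (by simp) fun y hy => bumpSeq_eq_zero hδ k ?_
      have := (abs_le.1 (hLip y)).2
      rw [hstep] at hx2
      linarith
    · have : bumpSeq P Z φ dw δ (k + 1) x
          = heatSmooth P Z (bumpTime dw δ k) (bumpSeq P Z φ dw δ k) x :=
        (if_neg hx1).trans (if_neg hx2)
      rw [this, sub_self, abs_zero]
      positivity

/-- For every `1`-Lipschitz function `φ` and `δ > 0` there is a function with values in `[0, 1]`
that is `1` where `φ ≤ 0`, vanishes where `φ ≥ δ`, and is Lipschitz in time under the semigroup,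
with constant of order `δ ^ (-dw)`. -/
theorem exists_lipschitz_bump (hZ : IsDiffusion P Z) (hC0 : 0 ≤ C) (hC : HasTailBound P Z dw C) :
    ∃ K : ℝ≥0, ∀ (φ : X → ℝ) (δ : ℝ), LipschitzWith 1 φ → 0 < δ →
      ∃ F : X → ℝ, Measurable F ∧ (∀ x, F x ∈ Set.Icc (0 : ℝ) 1) ∧ (∀ x, φ x ≤ 0 → F x = 1) ∧
        (∀ x, δ ≤ φ x → F x = 0) ∧ ∀ s x, |heat P Z s F x - F x| ≤ K / δ ^ dw * s := by
  set E : ℝ := C * (2 * 16 ^ dw) ^ 4 with hE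
  set q : ℝ := (2 ^ dw) ^ 4 with hq
  have hE0 : 0 ≤ E := by positivity
  have hq0 : 0 < q := by positivity
  -- bounds for the increments of the approximations and, after multiplication by `δ ^ (-dw)`, for
  -- the time-Lipschitz constants of these increments
  set w : ℕ → ℝ := fun k => (2 * E * q ^ k + 8) * (1 / 2) ^ 3 ^ k with hw
  have hw0 : ∀ k, 0 ≤ w k := fun k => by positivity
  have hws : Summable w := by
    have h1 := (summable_pow_mul_half_pow_three_pow q).mul_left (2 * E)
    have h2 := (summable_pow_mul_half_pow_three_pow 1).mul_left 8
    refine (h1.add h2).congr fun k => ?_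
    simp only [hw, one_pow]
    ring
  refine ⟨⟨4 + ∑' k, w k, add_nonneg (by norm_num) (tsum_nonneg hw0)⟩, fun φ δ hφ hδ => ?_⟩
  have hδw : 0 < δ ^ dw := by positivity
  have ht := fun k => bumpTime_pos (dw := dw) hδ k
  have hfm := fun k => (hZ.bumpSeq_measurable_mem_Icc (dw := dw) hφ.continuous hδ k).1
  have hf01 := fun k => (hZ.bumpSeq_measurable_mem_Icc (dw := dw) hφ.continuous hδ k).2
  have habs : ∀ {f : X → ℝ}, (∀ x, f x ∈ Set.Icc (0 : ℝ) 1) → ∀ x, |f x| ≤ 1 := fun hf y =>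
    abs_le.2 ⟨by linarith [(hf y).1], (hf y).2⟩
  set f := bumpSeq P Z φ dw δ with hf
  set g : ℕ → X → ℝ := fun k => heatSmooth P Z (bumpTime dw δ k) (f k) with hg
  have hgm : ∀ k, Measurable (g k) := fun k => hZ.measurable_heatSmooth (hfm k) (ht k)
  have hg01 : ∀ k x, g k x ∈ Set.Icc (0 : ℝ) 1 := fun k =>
    hZ.heatSmooth_mem_Icc (hfm k) (hf01 k) (ht k)
  have hσ1 : ∀ k, ((1 : ℝ) / 2) ^ 3 ^ k ≤ 1 := fun k => pow_le_one₀ (by norm_num) (by norm_num)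
  have hσ0 : ∀ k, 0 < ((1 : ℝ) / 2) ^ 3 ^ k := fun k => by positivity
  have hσs : ∀ k, ((1 : ℝ) / 2) ^ 3 ^ (k + 1) = ((1 / 2) ^ 3 ^ k) ^ 3 := fun k => by
    rw [pow_succ 3, pow_mul]
  have herr : ∀ k x, |f (k + 1) x - g k x| ≤ E * q ^ k * ((1 / 2) ^ 3 ^ k) ^ 4 := fun k x => by
    rw [abs_sub_comm]
    exact hZ.abs_heatSmooth_bumpSeq_sub_le hC0 hC hφ hδ k x
  have hσ4 : ∀ k, ((1 : ℝ) / 2) ^ 3 ^ k ≥ ((1 / 2) ^ 3 ^ k) ^ 4 := fun k =>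
    pow_le_of_le_one (hσ0 k).le (hσ1 k) (by norm_num)
  have herrm : ∀ k, Measurable fun x => f (k + 1) x - g k x := fun k => (hfm _).sub (hgm k)
  -- decomposition of the increments
  have hdec : ∀ k x, g (k + 1) x - g k x
      = heatSmooth P Z (bumpTime dw δ (k + 1)) (fun y => f (k + 1) y - g k y) x
        + (heatSmooth P Z (bumpTime dw δ (k + 1)) (g k) x - g k x) := by
    intro k x
    rw [hZ.heatSmooth_sub (hfm _) (habs (hf01 _)) (hgm k) (habs (hg01 k)) (ht _)]
    simp only [hg]
    ring
  have hinc : ∀ k x, |g (k + 1) x - g k x| ≤ w k := by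
    intro k x
    rw [hdec]
    have h1 := hZ.abs_heatSmooth_le (herrm k) (herr k) (ht (k + 1)) x
    have h2 : |heatSmooth P Z (bumpTime dw δ (k + 1)) (g k) x - g k x|
        ≤ 4 * bumpTime dw δ (k + 1) / bumpTime dw δ k := by
      refine hZ.abs_heatSmooth_sub_le (hgm k) (habs (hg01 k)) (ht _) fun v _ hv => ?_
      refine (hZ.abs_heat_heatSmooth_sub_le (hfm k) (habs (hf01 k)) v (ht k) x).trans ?_
      have := ht k
      gcongr ?_ / _
      linarith
    have h3 : 4 * bumpTime dw δ (k + 1) / bumpTime dw δ k = 4 * ((1 / 2) ^ 3 ^ k) ^ 2 := by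
      unfold bumpTime
      rw [hσs]
      have := (hσ0 k).ne'
      field_simp
    have h4 : ((1 : ℝ) / 2) ^ 3 ^ k ≥ ((1 / 2) ^ 3 ^ k) ^ 2 :=
      pow_le_of_le_one (hσ0 k).le (hσ1 k) (by norm_num)
    have h5 : E * q ^ k * ((1 / 2) ^ 3 ^ k) ^ 4 ≤ 2 * E * q ^ k * (1 / 2) ^ 3 ^ k := by
      have : 0 ≤ E * q ^ k := by positivity
      nlinarith [hσ4 k, hσ0 k, mul_le_mul_of_nonneg_left (hσ4 k) this,
        mul_nonneg this (hσ0 k).le]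
    calc _ ≤ _ := abs_add_le _ _
      _ ≤ w k := by
        simp only [hw]
        rw [h3] at h2
        rw [add_mul]
        linarith [hσ0 k]
  have hlipinc : ∀ k (s : ℝ≥0) x,
      |heat P Z s (fun y => g (k + 1) y - g k y) x - (g (k + 1) x - g k x)|
        ≤ w k / δ ^ dw * s := by
    intro k s x
    have e1 : (fun y => g (k + 1) y - g k y)
      = fun y => heatSmooth P Z (bumpTime dw δ (k + 1)) (fun y => f (k + 1) y - g k y) y
        - (g k y - heatSmooth P Z (bumpTime dw δ (k + 1)) (g k) y) := by
      funext y; rw [hdec]; ring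
    have hAm := hZ.measurable_heatSmooth (herrm k) (ht (k + 1))
    have hAb := hZ.abs_heatSmooth_le (herrm k) (herr k) (ht (k + 1))
    have hGm := hZ.measurable_heatSmooth (hgm k) (ht (k + 1))
    have hGb := hZ.abs_heatSmooth_le (hgm k) (habs (hg01 k)) (ht (k + 1))
    have hsubm : Measurable fun y => g k y - heatSmooth P Z (bumpTime dw δ (k + 1)) (g k) y :=
      (hgm k).sub hGm
    have hsubb : ∀ y, |g k y - heatSmooth P Z (bumpTime dw δ (k + 1)) (g k) y| ≤ 2 := fun y =>
      (abs_sub _ _).trans (by linarith [habs (hg01 k) y, hGb y])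
    have hb := hZ.abs_heat_heatSmooth_heatSmooth_sub_le (hfm k) (habs (hf01 k)) s (ht k)
      (ht (k + 1)) x
    have ha := hZ.abs_heat_heatSmooth_sub_le (herrm k) (herr k) s (ht (k + 1)) x
    have e2 : heat P Z s (fun y => g (k + 1) y - g k y) x
        = heat P Z s (heatSmooth P Z (bumpTime dw δ (k + 1)) (fun y => f (k + 1) y - g k y)) x
          + heat P Z s (fun y => heatSmooth P Z (bumpTime dw δ (k + 1)) (g k) y - g k y) x := by
      rw [e1, hZ.heat_sub hAm hAb hsubm hsubb,
        hZ.heat_sub (hgm k) (habs (hg01 k)) hGm hGb, hZ.heat_sub hGm hGb (hgm k) (habs (hg01 k))]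
      ring
    rw [e2, hdec, add_sub_add_comm]
    refine (abs_add_le _ _).trans ((add_le_add ha hb).trans_eq ?_)
    simp only [hw]
    unfold bumpTime
    rw [hσs]
    have := (hσ0 k).ne'
    field_simp
  have hlip : ∀ k (s : ℝ≥0) x,
      |heat P Z s (g k) x - g k x| ≤ (4 + ∑ j ∈ Finset.range k, w j) / δ ^ dw * s := by
    intro k s x
    induction k with
    | zero =>
      refine (hZ.abs_heat_heatSmooth_sub_le (hfm 0) (habs (hf01 0)) s (ht 0) x).trans_eq ?_
      unfold bumpTime
      simp only [pow_zero, pow_one, Finset.range_zero, Finset.sum_empty]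
      field_simp
      ring
    | succ k ih =>
      have h := hlipinc k s x
      rw [hZ.heat_sub (hgm _) (habs (hg01 _)) (hgm k) (habs (hg01 k))] at h
      have e : heat P Z s (g (k + 1)) x - g (k + 1) x = (heat P Z s (g k) x - g k x)
          + (heat P Z s (g (k + 1)) x - heat P Z s (g k) x - (g (k + 1) x - g k x)) := by ring
      rw [e, Finset.sum_range_succ]
      refine (abs_add_le _ _).trans ((add_le_add ih h).trans_eq ?_)
      ring
  have hlim : ∀ x, ∃ l, Tendsto (fun k => g k x) atTop (𝓝 l) := fun x =>
    cauchySeq_tendsto_of_complete (cauchySeq_of_dist_le_of_summable w (fun k => by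
      rw [dist_comm, Real.dist_eq]; exact hinc k x) hws)
  choose F hF using hlim
  have hF01 : ∀ x, F x ∈ Set.Icc (0 : ℝ) 1 := fun x =>
    isClosed_Icc.mem_of_tendsto (hF x) (Eventually.of_forall fun k => hg01 k x)
  have hFm : Measurable F := measurable_of_tendsto_metrizable hgm (tendsto_pi_nhds.2 hF)
  have hw_lim : Tendsto (fun k => E * q ^ k * ((1 / 2) ^ 3 ^ k) ^ 4) atTop (𝓝 0) := by
    refine squeeze_zero (fun k => by positivity) (fun k => ?_) hws.tendsto_atTop_zero
    have : 0 ≤ E * q ^ k := by positivity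
    simp only [hw]
    nlinarith [hσ4 k, hσ0 k, mul_le_mul_of_nonneg_left (hσ4 k) this,
        mul_nonneg this (hσ0 k).le]
  have hconst : ∀ x c, (∀ k, f (k + 1) x = c) → F x = c := by
    intro x c h
    refine tendsto_nhds_unique (hF x) ?_
    rw [tendsto_iff_dist_tendsto_zero]
    refine squeeze_zero (fun _ => dist_nonneg) (fun k => ?_) hw_lim
    rw [dist_comm, Real.dist_eq, ← h k]
    exact herr k x
  refine ⟨F, hFm, hF01, fun x hx => hconst x 1 fun k => bumpSeq_eq_one _ (hx.trans (by positivity)),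
    fun x hx => hconst x 0 fun k => bumpSeq_eq_zero hδ _ (le_trans ?_ hx), fun s x => ?_⟩
  · refine mul_le_of_le_one_right hδ.le ?_
    have : (0 : ℝ) ≤ (1 / 2) ^ (k + 1) / 8 := by positivity
    linarith
  · have := hZ.isMarkovKernel
    have h1 : Tendsto (fun k => heat P Z s (g k) x) atTop (𝓝 (heat P Z s F x)) := by
      refine tendsto_integral_of_dominated_convergence (fun _ => 1)
        (fun k => ((hgm k).comp (hZ.measurable s)).aestronglyMeasurable) (integrable_const _)
        (fun k => Eventually.of_forall fun ω => habs (hg01 k) _)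
        (Eventually.of_forall fun ω => hF _)
    refine le_of_tendsto (h1.sub (hF x)).abs (Eventually.of_forall fun k => (hlip k s x).trans ?_)
    change _ ≤ (4 + ∑' k, w k) / δ ^ dw * s
    gcongr
    exact hws.sum_le_tsum _ fun j _ => hw0 j

end IsDiffusion

/-! ### Consequences of the heat kernel bounds -/

namespace IsSubGaussianDensity

variable {X Ω : Type*} [MetricSpace X] [MeasurableSpace X] [MeasurableSpace Ω]
  {m : Measure X} {P : Kernel X Ω} {Z : ℝ≥0 → Ω → X} {n dw : ℝ} {p : ℝ≥0 → X → X → ℝ}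

theorem exists_pos_time (hp : IsSubGaussianDensity m P Z n dw p) :
    ∃ t : ℝ≥0, 0 < t ∧ ∀ x y, 0 < p t x y := by
  obtain ⟨c₁, c₂, c₃, c₄, t₀, h1, -, -, -, h0, -, hb⟩ := hp.bounds
  obtain ⟨t, ht, ht0⟩ := ENNReal.lt_iff_exists_nnreal_btwn.1 h0
  have ht' : 0 < t := by exact_mod_cast ht
  have ht'' : (0 : ℝ) < t := by exact_mod_cast ht
  exact ⟨t, ht', fun x y => lt_of_lt_of_le (by positivity) (hb t ht' ht0 x y).1⟩

theorem continuous_right (hp : IsSubGaussianDensity m P Z n dw p) {t : ℝ≥0} (ht : 0 < t) (x : X) :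
    Continuous (p t x) :=
  (hp.continuous t ht).comp (continuous_const.prodMk continuous_id)

theorem lintegral_eq_one (hZ : IsDiffusion P Z) (hp : IsSubGaussianDensity m P Z n dw p) {t : ℝ≥0}
    (ht : 0 < t) (x : X) : ∫⁻ y, ENNReal.ofReal (p t x y) ∂m = 1 := by
  have := hZ.isMarkovKernel
  have h := congrArg (fun μ => μ Set.univ) (hp.density t ht x)
  simp only [withDensity_apply _ MeasurableSet.univ, Measure.restrict_univ] at h
  rw [← h, Measure.map_apply (hZ.measurable t) MeasurableSet.univ]
  simp

variable [BorelSpace X]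

theorem integrable (hZ : IsDiffusion P Z) (hp : IsSubGaussianDensity m P Z n dw p) {t : ℝ≥0}
    (ht : 0 < t) (x : X) : Integrable (p t x) m := by
  refine ⟨(hp.continuous_right ht x).measurable.aestronglyMeasurable, ?_⟩
  rw [hasFiniteIntegral_iff_ofReal (Eventually.of_forall (hp.nonneg t ht x)),
    hp.lintegral_eq_one hZ ht]
  exact ENNReal.one_lt_top

theorem integral_eq_one (hZ : IsDiffusion P Z) (hp : IsSubGaussianDensity m P Z n dw p) {t : ℝ≥0}
    (ht : 0 < t) (x : X) : ∫ y, p t x y ∂m = 1 := by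
  rw [integral_eq_lintegral_of_nonneg_ae (Eventually.of_forall (hp.nonneg t ht x))
    (hp.integrable hZ ht x).aestronglyMeasurable, hp.lintegral_eq_one hZ ht, ENNReal.toReal_one]

theorem heat_eq_integral (hZ : IsDiffusion P Z) (hp : IsSubGaussianDensity m P Z n dw p) {t : ℝ≥0}
    (ht : 0 < t) {f : X → ℝ} (hf : Measurable f) (x : X) :
    heat P Z t f x = ∫ y, p t x y * f y ∂m := by
  have h1 : heat P Z t f x = ∫ y, f y ∂((P x).map (Z t)) :=
    (integral_map (hZ.measurable t).aemeasurable hf.aestronglyMeasurable).symm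
  rw [h1, hp.density t ht x, integral_withDensity_eq_integral_toReal_smul
    (hp.continuous_right ht x).measurable.ennreal_ofReal
    (Eventually.of_forall fun _ => ENNReal.ofReal_lt_top)]
  refine integral_congr_ae (Eventually.of_forall fun y => ?_)
  simp only [ENNReal.toReal_ofReal (hp.nonneg t ht x y), smul_eq_mul]

theorem measureReal_eq_integral (hZ : IsDiffusion P Z) (hp : IsSubGaussianDensity m P Z n dw p)
    {t : ℝ≥0} (ht : 0 < t) {S : Set X} (hS : MeasurableSet S) (x : X) :
    (P x).real {ω | Z t ω ∈ S} = ∫ y in S, p t x y ∂m := by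
  have h : P x {ω | Z t ω ∈ S} = ∫⁻ y in S, ENNReal.ofReal (p t x y) ∂m := by
    rw [← withDensity_apply _ hS, ← hp.density t ht x, Measure.map_apply (hZ.measurable t) hS]
    rfl
  rw [measureReal_def, h, integral_eq_lintegral_of_nonneg_ae
    (Eventually.of_forall (hp.nonneg t ht x))
    (hp.integrable hZ ht x).aestronglyMeasurable.restrict]

/-- The strong Feller property: since the densities `p t x` have integral `1` and depend
continuously on `x`, they are continuous in `L¹` (Scheffé's lemma). -/
theorem continuous_heat (hZ : IsDiffusion P Z) (hp : IsSubGaussianDensity m P Z n dw p) {t : ℝ≥0}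
    (ht : 0 < t) {f : X → ℝ} (hf : Measurable f) {B : ℝ} (hB : ∀ x, |f x| ≤ B) :
    Continuous (heat P Z t f) := by
  rw [continuous_iff_continuousAt]
  intro x
  have hB0 : 0 ≤ B := (abs_nonneg _).trans (hB x)
  have hi := fun x => hp.integrable hZ ht x
  have hpos : Tendsto (fun x' => ∫ y, max (p t x y - p t x' y) 0 ∂m) (𝓝 x) (𝓝 0) := by
    have h := tendsto_integral_filter_of_dominated_convergence (μ := m) (l := 𝓝 x)
      (F := fun x' y => max (p t x y - p t x' y) 0) (f := fun _ => 0) (p t x)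
      (Eventually.of_forall fun x' => (((hp.continuous_right ht x).sub
        (hp.continuous_right ht x')).max continuous_const).measurable.aestronglyMeasurable)
      (Eventually.of_forall fun x' => Eventually.of_forall fun y => by
        rw [Real.norm_eq_abs, abs_of_nonneg (le_max_right _ _)]
        exact max_le (by linarith [hp.nonneg t ht x' y]) (hp.nonneg t ht x y))
      (hi x) (Eventually.of_forall fun y => by
        have hc : Continuous fun x' => max (p t x y - p t x' y) 0 :=
          (continuous_const.sub ((hp.continuous t ht).comp
            (continuous_id.prodMk continuous_const))).max continuous_const
        simpa using hc.tendsto x)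
    simpa using h
  rw [ContinuousAt, tendsto_iff_dist_tendsto_zero]
  have hlim := hpos.const_mul (2 * B)
  rw [mul_zero] at hlim
  refine squeeze_zero (fun _ => dist_nonneg) (fun x' => ?_) hlim
  have hfi : ∀ z, Integrable (fun y => p t z y * f y) m := fun z =>
    (hi z).mul_bdd (c := B) hf.aestronglyMeasurable (Eventually.of_forall hB)
  have hmax : Integrable (fun y => max (p t x y - p t x' y) 0) m := ((hi x).sub (hi x')).pos_part
  have hdiff : Integrable (fun y => p t x y - p t x' y) m := (hi x).sub (hi x')
  rw [dist_comm, Real.dist_eq, hp.heat_eq_integral hZ ht hf, hp.heat_eq_integral hZ ht hf,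
    ← integral_sub (hfi x) (hfi x'), ← Real.norm_eq_abs]
  calc ‖∫ y, (p t x y * f y - p t x' y * f y) ∂m‖
      ≤ ∫ y, B * (2 * max (p t x y - p t x' y) 0 - (p t x y - p t x' y)) ∂m := by
        refine norm_integral_le_of_norm_le (((hmax.const_mul 2).sub hdiff).const_mul B)
          (Eventually.of_forall fun y => ?_)
        have e : 2 * max (p t x y - p t x' y) 0 - (p t x y - p t x' y)
            = |p t x y - p t x' y| := by
          rcases le_total 0 (p t x y - p t x' y) with h | h
          · rw [max_eq_left h, abs_of_nonneg h]; ring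
          · rw [max_eq_right h, abs_of_nonpos h]; ring
        rw [e, ← sub_mul, Real.norm_eq_abs, abs_mul, mul_comm]
        gcongr
        exact hB y
    _ = 2 * B * ∫ y, max (p t x y - p t x' y) 0 ∂m := by
        rw [integral_const_mul, integral_sub (hmax.const_mul 2) hdiff, integral_const_mul,
          integral_sub (hi x) (hi x'), hp.integral_eq_one hZ ht, hp.integral_eq_one hZ ht]
        ring

theorem continuous_of_lipschitz (hZ : IsDiffusion P Z) (hp : IsSubGaussianDensity m P Z n dw p)
    {f : X → ℝ} (hf : Measurable f) {B : ℝ} (hB : ∀ x, |f x| ≤ B) {L : ℝ}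
    (hL : ∀ s x, |heat P Z s f x - f x| ≤ L * s) : Continuous f := by
  have h : TendstoUniformly (fun s : ℝ≥0 => heat P Z s f) f (𝓝[>] 0) := by
    rw [Metric.tendstoUniformly_iff]
    intro ε hε
    have hlim : Tendsto (fun s : ℝ≥0 => L * (s : ℝ)) (𝓝[>] 0) (𝓝 0) := by
      have hc : Continuous fun s : ℝ≥0 => L * (s : ℝ) := by fun_prop
      simpa using (hc.tendsto 0).mono_left (nhdsWithin_le_nhds (s := Set.Ioi 0))
    filter_upwards [hlim.eventually (gt_mem_nhds hε)] with s hs x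
    rw [dist_comm, Real.dist_eq]
    exact (hL s x).trans_lt hs
  refine h.continuous (Eventually.frequently ?_)
  filter_upwards [self_mem_nhdsWithin] with s hs
  exact hp.continuous_heat hZ hs hf hB

theorem isLocallyFiniteMeasure (hZ : IsDiffusion P Z) (hp : IsSubGaussianDensity m P Z n dw p) :
    IsLocallyFiniteMeasure m := by
  obtain ⟨t, ht, hpos⟩ := hp.exists_pos_time
  refine ⟨fun x => ⟨{y | p t x x / 2 < p t x y}, ?_, ?_⟩⟩
  · exact (isOpen_lt continuous_const (hp.continuous_right ht x)).mem_nhds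
      (half_lt_self (hpos x x))
  · have h := mul_meas_ge_le_lintegral₀ (μ := m)
      (hp.continuous_right ht x).measurable.ennreal_ofReal.aemeasurable
      (ENNReal.ofReal (p t x x / 2))
    rw [hp.lintegral_eq_one hZ ht] at h
    have hc : 0 < ENNReal.ofReal (p t x x / 2) := ENNReal.ofReal_pos.2 (half_pos (hpos x x))
    refine lt_of_le_of_lt (measure_mono fun y hy => ?_)
      (ENNReal.lt_top_of_mul_ne_top_right (ne_top_of_le_ne_top ENNReal.one_ne_top h) hc.ne')
    exact ENNReal.ofReal_le_ofReal (le_of_lt hy)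

end IsSubGaussianDensity

/-! ### The tail bound -/

theorem exp_neg_le_rpow {q y : ℝ} (hq : 0 < q) (hy : 0 < y) : Real.exp (-y) ≤ (q / y) ^ q := by
  have h1 : y / q ≤ Real.exp (y / q) := by linarith [Real.add_one_le_exp (y / q)]
  have h2 : (y / q) ^ q ≤ Real.exp y := by
    calc (y / q) ^ q ≤ Real.exp (y / q) ^ q := by gcongr
      _ = Real.exp y := by rw [← Real.exp_mul, div_mul_cancel₀ _ hq.ne']
  rw [Real.exp_neg, ← inv_div, Real.inv_rpow (by positivity)]
  exact inv_anti₀ (by positivity) h2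

/-- Two-sided sub-Gaussian bounds imply a polynomial bound for large displacements: away from the
diagonal the upper bound for `p u` is smaller than the lower bound for `p (A u)`, with `A` large
enough, by an arbitrary power of `u / d ^ dw`, and `p (A u)` is a probability density. -/
theorem IsSubGaussianDensity.exists_hasTailBound {X Ω : Type*} [MetricSpace X] [MeasurableSpace X]
    [BorelSpace X] [MeasurableSpace Ω] {m : Measure X} {P : Kernel X Ω} {Z : ℝ≥0 → Ω → X}
    {n dw : ℝ} {p : ℝ≥0 → X → X → ℝ} (hZ : IsDiffusion P Z)
    (hp : IsSubGaussianDensity m P Z n dw p) (hdw : 1 < dw) :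
    ∃ C : ℝ, 0 ≤ C ∧ HasTailBound P Z dw C := by
  have hM := hZ.isMarkovKernel
  obtain ⟨c₁, c₂, c₃, c₄, t₀, h1, h2, h3, h4, h0, hunb, hb⟩ := hp.bounds
  set a : ℝ := 1 / (dw - 1) with ha
  have hdw1 : 0 < dw - 1 := by linarith
  have ha0 : 0 < a := by positivity
  set A : ℝ≥0 := max 1 ⟨(2 * c₂ / c₄) ^ (dw - 1), by positivity⟩ with hA
  have hA1 : 1 ≤ A := le_max_left _ _
  have hA0 : (0 : ℝ) < A := by exact_mod_cast lt_of_lt_of_le one_pos hA1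
  have hAa : 2 * c₂ / c₄ ≤ (A : ℝ) ^ a := by
    have e : (2 * c₂ / c₄) ^ (dw - 1) ≤ (A : ℝ) := by
      exact_mod_cast (le_max_right 1 (⟨(2 * c₂ / c₄) ^ (dw - 1), by positivity⟩ : ℝ≥0))
    calc 2 * c₂ / c₄ = ((2 * c₂ / c₄) ^ (dw - 1)) ^ a := by
          rw [← Real.rpow_mul (by positivity), ha, mul_one_div_cancel hdw1.ne', Real.rpow_one]
      _ ≤ (A : ℝ) ^ a := by gcongr
  set q : ℝ := 4 * (dw - 1) with hq
  have hq0 : 0 < q := by positivity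
  set C₁ : ℝ := c₃ / c₁ * (A : ℝ) ^ (n / dw) * (2 * q / c₄) ^ q with hC₁
  have hC₁0 : 0 ≤ C₁ := by positivity
  obtain ⟨Δ, hΔ0, hΔ⟩ : ∃ Δ : ℝ, 0 ≤ Δ ∧
      (Bornology.IsBounded (Set.univ : Set X) → ∀ x y : X, dist x y ≤ Δ) := by
    by_cases hbd : Bornology.IsBounded (Set.univ : Set X)
    · obtain ⟨Δ, hΔ⟩ := Metric.isBounded_iff.1 hbd
      exact ⟨max Δ 0, le_max_right _ _, fun _ x y =>
        (hΔ (Set.mem_univ x) (Set.mem_univ y)).trans (le_max_left _ _)⟩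
    · exact ⟨0, le_rfl, fun h => absurd h hbd⟩
  set C₂ : ℝ := (A * Δ ^ dw / t₀.toReal) ^ 4 with hC₂
  have hC₂0 : 0 ≤ C₂ := by positivity
  have hpt : ∀ (u : ℝ≥0) (d : ℝ) (x y : X), 0 < u → 0 < d → ((A * u : ℝ≥0) : ℝ≥0∞) < t₀ →
      d ≤ dist x y → p u x y ≤ C₁ * ((u : ℝ) / d ^ dw) ^ 4 * p (A * u) x y := by
    intro u d x y hu hd hAu hxy
    have hu' : (0 : ℝ) < u := by exact_mod_cast hu
    have hut : (u : ℝ≥0∞) < t₀ := lt_of_le_of_lt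
      (by exact_mod_cast le_mul_of_one_le_left zero_le hA1) hAu
    have hup := (hb u hu hut x y).2
    have hlow := (hb (A * u) (by positivity) hAu x y).1
    set D := dist x y with hD
    have hD0 : 0 < D := hd.trans_le hxy
    set w : ℝ := (D ^ dw / u) ^ a with hw
    have hw0 : 0 < w := by positivity
    have e1 : (D ^ dw / ((A * u : ℝ≥0) : ℝ)) ^ a = w / (A : ℝ) ^ a := by
      push_cast
      rw [mul_comm (A : ℝ), ← div_div, Real.div_rpow (by positivity) hA0.le]
    have e2 : c₂ * (w / (A : ℝ) ^ a) ≤ c₄ / 2 * w := by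
      rw [mul_div_assoc', div_le_iff₀ (by positivity)]
      have : c₂ ≤ c₄ / 2 * (A : ℝ) ^ a := by
        rw [div_le_iff₀ h4] at hAa
        linarith
      nlinarith
    have e3 : Real.exp (-(c₄ / 2 * w)) ≤ (2 * q / c₄) ^ q * ((u : ℝ) / d ^ dw) ^ 4 := by
      refine (exp_neg_le_rpow hq0 (by positivity)).trans ?_
      have e : q / (c₄ / 2 * w) = 2 * q / c₄ * w⁻¹ := by field_simp
      rw [e, Real.mul_rpow (by positivity) (by positivity)]
      gcongr
      have e' : w⁻¹ ^ q = ((u : ℝ) / D ^ dw) ^ 4 := by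
        rw [hw, ← Real.inv_rpow (by positivity), inv_div, ← Real.rpow_mul (by positivity), ha, hq,
          show 1 / (dw - 1) * (4 * (dw - 1)) = (4 : ℕ) by field_simp; norm_num,
          Real.rpow_natCast]
      rw [e']
      gcongr
    have e4 : c₁ / ((A : ℝ) * u) ^ (n / dw) * Real.exp (-(c₄ / 2 * w)) ≤ p (A * u) x y := by
      refine le_trans ?_ hlow
      rw [e1, neg_mul]
      push_cast
      gcongr
    calc p u x y ≤ c₃ / (u : ℝ) ^ (n / dw) * Real.exp (-c₄ * w) := hup
      _ = c₃ / (u : ℝ) ^ (n / dw) * Real.exp (-(c₄ / 2 * w)) * Real.exp (-(c₄ / 2 * w)) := by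
          rw [mul_assoc, ← Real.exp_add]; congr 2; ring
      _ ≤ c₃ / (u : ℝ) ^ (n / dw) * Real.exp (-(c₄ / 2 * w))
            * ((2 * q / c₄) ^ q * ((u : ℝ) / d ^ dw) ^ 4) := by gcongr
      _ = C₁ * ((u : ℝ) / d ^ dw) ^ 4
            * (c₁ / ((A : ℝ) * u) ^ (n / dw) * Real.exp (-(c₄ / 2 * w))) := by
          rw [Real.mul_rpow hA0.le hu'.le, hC₁]
          field_simp
      _ ≤ _ := by gcongr
  refine ⟨C₁ + C₂, by positivity, fun u d x hu hd => ?_⟩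
  have hu' : (0 : ℝ) < u := by exact_mod_cast hu
  have hr0 : 0 ≤ ((u : ℝ) / d ^ dw) ^ 4 := by positivity
  rcases lt_or_ge ((A * u : ℝ≥0) : ℝ≥0∞) t₀ with hAu | hAu
  · have hS : MeasurableSet {y | d ≤ dist x y} :=
      (isClosed_le continuous_const (continuous_const.dist continuous_id)).measurableSet
    have hAu0 : 0 < A * u := by positivity
    have hi := hp.integrable hZ hAu0 x
    refine (hp.measureReal_eq_integral hZ hu hS x).trans_le ?_
    calc ∫ y in {y | d ≤ dist x y}, p u x y ∂m
        ≤ ∫ y in {y | d ≤ dist x y}, C₁ * ((u : ℝ) / d ^ dw) ^ 4 * p (A * u) x y ∂m :=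
          setIntegral_mono_on (hp.integrable hZ hu x).integrableOn (hi.const_mul _).integrableOn hS
            fun y hy => hpt u d x y hu hd hAu hy
      _ ≤ ∫ y, C₁ * ((u : ℝ) / d ^ dw) ^ 4 * p (A * u) x y ∂m :=
          setIntegral_le_integral (hi.const_mul _) (Eventually.of_forall fun y =>
            mul_nonneg (by positivity) (hp.nonneg _ hAu0 x y))
      _ = C₁ * ((u : ℝ) / d ^ dw) ^ 4 := by
          rw [integral_const_mul, hp.integral_eq_one hZ hAu0, mul_one]
      _ ≤ _ := by gcongr; linarith
  · -- times beyond `t₀` only occur in the bounded case, where `d` may be assumed to be bounded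
    have htop : t₀ ≠ ⊤ := ne_top_of_le_ne_top ENNReal.coe_ne_top hAu
    have hbd : Bornology.IsBounded (Set.univ : Set X) := by
      by_contra h
      exact htop (hunb h)
    rcases le_or_gt d Δ with hdΔ | hdΔ
    · have ht : t₀.toReal ≤ A * u := by
        have := ENNReal.toReal_mono ENNReal.coe_ne_top hAu
        simpa using this
      have ht0 : 0 < t₀.toReal := ENNReal.toReal_pos h0.ne' htop
      have hd' : d ^ dw ≤ Δ ^ dw := Real.rpow_le_rpow hd.le hdΔ (by linarith)
      have hone : 1 ≤ A * Δ ^ dw / t₀.toReal * ((u : ℝ) / d ^ dw) := by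
        rw [div_mul_div_comm, one_le_div (by positivity)]
        calc t₀.toReal * d ^ dw ≤ (A * u) * Δ ^ dw := by gcongr
          _ = _ := by ring
      calc (P x).real {ω | d ≤ dist x (Z u ω)} ≤ 1 := measureReal_le_one
        _ ≤ (A * Δ ^ dw / t₀.toReal * ((u : ℝ) / d ^ dw)) ^ 4 := one_le_pow₀ hone
        _ = C₂ * ((u : ℝ) / d ^ dw) ^ 4 := by rw [mul_pow]
        _ ≤ _ := by gcongr; linarith
    · have : {ω | d ≤ dist x (Z u ω)} = ∅ := by
        ext ω
        simpa using (hΔ hbd x (Z u ω)).trans_lt hdΔ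
      rw [this, measureReal_empty]
      positivity

/-! ### Bump functions with null boundary -/

namespace IsSubGaussianDensity

variable {X Ω : Type*} [MetricSpace X] [MeasurableSpace X] [BorelSpace X]
  [MeasurableSpace Ω] {m : Measure X} {P : Kernel X Ω} {Z : ℝ≥0 → Ω → X} {n dw : ℝ}
  {p : ℝ≥0 → X → X → ℝ}

/-- A convex combination of the functions of `IsDiffusion.exists_lipschitz_bump`, over an exhaustion
of `{φ < ρ}`, which is positive exactly on `{φ < ρ}`. The weights decay fast enough to compensate
for the growth of the Lipschitz constants. -/
theorem exists_lipschitz_bump_pos_iff (hZ : IsDiffusion P Z)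
    (hp : IsSubGaussianDensity m P Z n dw p) (hdw : 1 < dw) :
    ∃ K : ℝ≥0, ∀ (φ : X → ℝ) (ρ : ℝ), LipschitzWith 1 φ → 0 < ρ →
      ∃ h : X → ℝ, Continuous h ∧ (∀ x, h x ∈ Set.Icc (0 : ℝ) 1) ∧ (∀ x, φ x ≤ 0 → h x = 1) ∧
        (∀ x, 0 < h x ↔ φ x < ρ) ∧ ∀ s x, |heat P Z s h x - h x| ≤ K / ρ ^ dw * s := by
  obtain ⟨C, hC0, hC⟩ := hp.exists_hasTailBound hZ hdw
  obtain ⟨K, hK⟩ := hZ.exists_lipschitz_bump hC0 hC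
  refine ⟨2 * K, fun φ ρ hφ hρ => ?_⟩
  have hstep : ∀ j : ℕ, ∃ F : X → ℝ, Measurable F ∧ (∀ x, F x ∈ Set.Icc (0 : ℝ) 1) ∧
      (∀ x, φ x ≤ ρ * (1 - (1 / 2) ^ j) → F x = 1) ∧ (∀ x, ρ ≤ φ x → F x = 0) ∧
      ∀ s x, |heat P Z s F x - F x| ≤ K / (ρ * (1 / 2) ^ j) ^ dw * s := by
    intro j
    obtain ⟨F, h1, h2, h3, h4, h5⟩ := hK (fun x => φ x - ρ * (1 - (1 / 2) ^ j))
      (ρ * (1 / 2) ^ j) (LipschitzWith.of_dist_le_mul fun x y => by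
        simpa using hφ.dist_le_mul x y) (by positivity)
    exact ⟨F, h1, h2, fun x hx => h3 x (by linarith), fun x hx => h4 x (by linarith), h5⟩
  choose F hFm hF01 hF1 hF0 hFL using hstep
  have hFb : ∀ j x, |F j x| ≤ 1 := fun j x => abs_le.2 ⟨by linarith [(hF01 j x).1], (hF01 j x).2⟩
  have hFc : ∀ j, Continuous (F j) := fun j =>
    hp.continuous_of_lipschitz hZ (hFm j) (hFb j) (hFL j)
  set r : ℝ := (2 ^ dw)⁻¹ / 2 with hr
  have h2dw : (1 : ℝ) ≤ 2 ^ dw := Real.one_le_rpow (by norm_num) (by linarith)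
  have hr0 : 0 < r := by positivity
  have hr1 : r < 1 := by
    have := inv_le_one_of_one_le₀ h2dw
    linarith
  set w : ℕ → ℝ := fun j => (1 - r) * r ^ j with hw
  have hw0 : ∀ j, 0 < w j := fun j => mul_pos (by linarith) (by positivity)
  have hws : HasSum w 1 := by
    have h := (hasSum_geometric_of_lt_one hr0.le hr1).mul_left (1 - r)
    rwa [mul_inv_cancel₀ (by linarith)] at h
  have hwF : ∀ x, Summable fun j => w j * F j x := fun x =>
    Summable.of_nonneg_of_le (fun j => mul_nonneg (hw0 j).le (hF01 j x).1)
      (fun j => mul_le_of_le_one_right (hw0 j).le (hF01 j x).2) hws.summable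
  set h : X → ℝ := fun x => ∑' j, w j * F j x with hh
  have hh0 : ∀ x, 0 ≤ h x := fun x => tsum_nonneg fun j => mul_nonneg (hw0 j).le (hF01 j x).1
  have hh1 : ∀ x, h x ≤ 1 := fun x => by
    rw [← hws.tsum_eq]
    exact (hwF x).tsum_le_tsum (fun j => mul_le_of_le_one_right (hw0 j).le (hF01 j x).2)
      hws.summable
  refine ⟨h, ?_, fun x => ⟨hh0 x, hh1 x⟩, fun x hx => ?_, fun x => ⟨fun hpos => ?_, fun hx => ?_⟩,
    fun s x => ?_⟩
  · refine continuous_tsum (fun j => (hFc j).const_mul _) hws.summable fun j x => ?_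
    rw [Real.norm_eq_abs, abs_mul, abs_of_pos (hw0 j)]
    exact mul_le_of_le_one_right (hw0 j).le (hFb j x)
  · have : ∀ j, F j x = 1 := fun j => hF1 j x (hx.trans (mul_nonneg hρ.le
      (sub_nonneg.2 (pow_le_one₀ (by norm_num) (by norm_num)))))
    simp only [hh, this, mul_one, hws.tsum_eq]
  · by_contra hx
    have : ∀ j, F j x = 0 := fun j => hF0 j x (not_lt.1 hx)
    simp [hh, this] at hpos
  · have hlim : Tendsto (fun j : ℕ => ρ * (1 - (1 / 2 : ℝ) ^ j)) atTop (𝓝 (ρ * (1 - 0))) :=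
      ((tendsto_pow_atTop_nhds_zero_of_lt_one (by norm_num) (by norm_num)).const_sub 1).const_mul ρ
    rw [sub_zero, mul_one] at hlim
    obtain ⟨j, hj⟩ := (hlim.eventually (lt_mem_nhds hx)).exists
    calc 0 < w j * F j x := by rw [hF1 j x hj.le, mul_one]; exact hw0 j
      _ ≤ h x := (hwF x).le_tsum j fun i _ => mul_nonneg (hw0 i).le (hF01 i x).1
  · have := hZ.isMarkovKernel
    have hsum : HasSum (fun j => w j * heat P Z s (F j) x) (heat P Z s h x) := by
      have hi : ∀ j, Integrable (fun ω => w j * F j (Z s ω)) (P x) := fun j =>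
        (hZ.integrable_comp (hFm j) (hFb j) s x).const_mul _
      have := hasSum_integral_of_summable_integral_norm hi
        (Summable.of_nonneg_of_le (fun j => integral_nonneg fun ω => norm_nonneg _) (fun j => by
          have hle := norm_integral_le_of_norm_le_const (μ := P x)
            (f := fun ω => ‖w j * F j (Z s ω)‖) (C := w j) (Eventually.of_forall fun ω => by
              rw [norm_norm, Real.norm_eq_abs, abs_mul, abs_of_pos (hw0 j)]
              exact mul_le_of_le_one_right (hw0 j).le (hFb j _))
          simpa using (le_abs_self _).trans hle) hws.summable)
      simp only [integral_const_mul] at this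
      exact this
    have hdiff : HasSum (fun j => w j * (heat P Z s (F j) x - F j x))
        (heat P Z s h x - h x) := by
      simpa only [mul_sub] using hsum.sub (hwF x).hasSum
    have hmaj : HasSum (fun j => (1 - r) * (K / ρ ^ dw) * s * (1 / 2) ^ j)
        ((1 - r) * (K / ρ ^ dw) * s * 2) := hasSum_geometric_two.mul_left _
    have hle : ∀ j, ‖w j * (heat P Z s (F j) x - F j x)‖
        ≤ (1 - r) * (K / ρ ^ dw) * s * (1 / 2) ^ j := by
      intro j
      rw [Real.norm_eq_abs, abs_mul, abs_of_pos (hw0 j)]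
      refine (mul_le_mul_of_nonneg_left (hFL j s x) (hw0 j).le).trans_eq ?_
      have e : ((1 / 2 : ℝ) ^ j) ^ dw = ((2 ^ dw) ^ j)⁻¹ := by
        rw [one_div, inv_pow, Real.inv_rpow (by positivity), ← Real.rpow_natCast,
          ← Real.rpow_mul (by norm_num), mul_comm, Real.rpow_mul (by norm_num), Real.rpow_natCast]
      rw [Real.mul_rpow hρ.le (by positivity), e]
      simp only [hw, hr, div_pow, inv_pow, one_pow]
      have : (0 : ℝ) < 2 ^ dw := by positivity
      field_simp
    rw [← hdiff.tsum_eq, ← Real.norm_eq_abs]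
    refine (tsum_of_norm_bounded hmaj hle).trans ?_
    push_cast
    have : 0 ≤ (K : ℝ) / ρ ^ dw * s := by positivity
    calc (1 - r) * (K / ρ ^ dw) * s * 2 = (1 - r) * (2 * (K / ρ ^ dw * s)) := by ring
      _ ≤ 1 * (2 * (K / ρ ^ dw * s)) := by gcongr; linarith
      _ = _ := by ring

variable [ProperSpace X]

/-- Bump functions for a compact set and its `δ`-neighbourhood, with a time-Lipschitz constant of
order `δ ^ (-dw)`. -/
theorem exists_isBump_thickening (hZ : IsDiffusion P Z)
    (hp : IsSubGaussianDensity m P Z n dw p) (hdw : 1 < dw) :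
    ∃ K : ℝ≥0, ∀ (S : Set X) (δ : ℝ≥0), IsCompact S → 0 < δ →
      ∃ f ∈ hZ.lipschitzSpace, IsBump m S (Metric.thickening δ S) f ∧
        ∀ s x, |heat P Z s f x - f x| ≤ (K / δ ^ dw : ℝ≥0) * s := by
  obtain ⟨K, hK⟩ := hp.exists_lipschitz_bump_pos_iff hZ hdw
  refine ⟨2 ^ dw * K, fun S δ hS hδ => ?_⟩
  have hδ' : (0 : ℝ) < δ := by exact_mod_cast hδ
  have := hp.isLocallyFiniteMeasure hZ
  rcases S.eq_empty_or_nonempty with rfl | hne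
  · exact ⟨0, zero_mem _, ⟨by simp, by simp, by simp, by simp, by simp⟩, fun s x => by
      simp [heat]; positivity⟩
  set φ : X → ℝ := fun x => Metric.infDist x S with hφdef
  have hφ : LipschitzWith 1 φ := Metric.lipschitz_infDist_pt S
  -- all but countably many level sets of the distance are null sets
  obtain ⟨ρ, hρ, hρ1, hρ2⟩ := (Measure.countable_meas_level_set_pos (μ := m)
    hφ.continuous.measurable).dense_compl ℝ |>.exists_between (half_lt_self hδ')
  have hnull : m {x | φ x = ρ} = 0 := by simpa using hρ
  have hρ0 : 0 < ρ := (half_pos hδ').trans hρ1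
  obtain ⟨h, hc, h01, h1, hpos, hL⟩ := hK φ ρ hφ hρ0
  have hzero : ∀ x, ρ ≤ φ x → h x = 0 := fun x hx =>
    le_antisymm (not_lt.1 fun hh => not_lt.2 hx ((hpos x).1 hh)) (h01 x).1
  have hcs : HasCompactSupport h := by
    refine HasCompactSupport.intro (hS.cthickening (r := ρ)) fun x hx => hzero x ?_
    by_contra hlt
    obtain ⟨y, hy, hxy⟩ := hS.exists_infDist_eq_dist hne x
    exact hx (Metric.mem_cthickening_of_dist_le x y ρ S hy (hxy ▸ (not_le.1 hlt).le))
  have hLδ : ∀ s x, |heat P Z s h x - h x| ≤ (2 ^ dw * K / δ ^ dw : ℝ≥0) * s := by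
    intro s x
    refine (hL s x).trans ?_
    gcongr
    push_cast
    rw [div_le_div_iff₀ (by positivity) (by positivity), mul_comm (2 ^ dw : ℝ), mul_assoc,
      ← Real.mul_rpow (by norm_num) hρ0.le]
    gcongr
    linarith
  refine ⟨⟨⟨h, hc⟩, hcs.is_zero_at_infty⟩, ⟨_, hLδ⟩, ⟨fun x hx => ?_, fun x hx => ?_,
    fun x => (h01 x).1, fun x => (h01 x).2, ?_⟩, hLδ⟩
  · exact h1 x (Metric.infDist_zero_of_mem hx).le
  · refine hzero x ?_
    by_contra hlt
    obtain ⟨y, hy, hxy⟩ := hS.exists_infDist_eq_dist hne x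
    exact hx (Metric.mem_thickening_iff.2 ⟨y, hy, hxy ▸ (not_le.1 hlt).trans hρ2⟩)
  · have e : {x | 0 < h x} = {x | φ x < ρ} := Set.ext hpos
    change m (frontier {x | 0 < h x}) = 0
    rw [e]
    exact measure_mono_null (frontier_lt_subset_eq hφ.continuous continuous_const) hnull

/-! ### Symmetry -/

theorem integral_mul_heat_comm (hZ : IsDiffusion P Z) (hp : IsSubGaussianDensity m P Z n dw p)
    {f g : X → ℝ} (hf : Continuous f) (hfc : HasCompactSupport f) (hg : Continuous g)
    (hgc : HasCompactSupport g) (t : ℝ≥0) :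
    ∫ x, f x * heat P Z t g x ∂m = ∫ x, heat P Z t f x * g x ∂m := by
  have := hp.isLocallyFiniteMeasure hZ
  rcases eq_or_lt_of_le (zero_le : 0 ≤ t) with rfl | ht
  · simp_rw [hZ.heat_zero]
  simp_rw [hp.heat_eq_integral hZ ht hg.measurable, hp.heat_eq_integral hZ ht hf.measurable,
    ← integral_const_mul, ← integral_mul_const]
  rw [integral_integral_swap]
  · simp_rw [hp.symm t ht]
    refine integral_congr_ae (Eventually.of_forall fun x => integral_congr_ae
      (Eventually.of_forall fun y => ?_))
    ring
  · refine Continuous.integrable_of_hasCompactSupport ?_ ?_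
    · exact (hf.comp continuous_fst).mul ((hp.continuous t ht).mul (hg.comp continuous_snd))
    · refine HasCompactSupport.intro (hfc.isCompact.prod hgc.isCompact) fun z hz => ?_
      rw [Set.mem_prod, not_and_or] at hz
      rcases hz with hz | hz
      · simp [Function.uncurry, image_eq_zero_of_notMem_tsupport hz]
      · simp [Function.uncurry, image_eq_zero_of_notMem_tsupport hz]

theorem isSymmetricOp {Ω' : Type*} [MeasurableSpace Ω'] {Q : Measure Ω'} [IsProbabilityMeasure Q]
    {η : ℝ≥0 → Ω' → ℝ≥0} (hη : ∀ t, Measurable (η t)) (hZ : IsDiffusion P Z)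
    (hp : IsSubGaussianDensity m P Z n dw p) :
    IsSymmetricOp m (transitionOp (fun x => (P x).prod Q) (subordinate Z η)) := by
  intro t f g hf hfc hg hgc
  have := hp.isLocallyFiniteMeasure hZ
  have hbdd : ∀ {k : X → ℝ}, Continuous k → HasCompactSupport k → ∃ B, ∀ x, |k x| ≤ B :=
    fun hk hkc => hk.bounded_above_of_compact_support hkc
  obtain ⟨Bf, hBf⟩ := hbdd hf hfc
  obtain ⟨Bg, hBg⟩ := hbdd hg hgc
  have hmeas : ∀ {k : X → ℝ}, Continuous k →
      Measurable fun z : X × Ω' => heat P Z (η t z.2) k z.1 :=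
    fun hk => (hZ.measurable_heat_uncurry hk.measurable).comp
      (((hη t).comp measurable_snd).prodMk measurable_fst)
  have hif : Integrable (fun z : X × Ω' => f z.1 * heat P Z (η t z.2) g z.1) (m.prod Q) :=
    ((hf.integrable_of_hasCompactSupport hfc).comp_fst Q).mul_bdd (c := Bg)
      (hmeas hg).aestronglyMeasurable (Eventually.of_forall fun z => hZ.abs_heat_le hBg _ _)
  have hig : Integrable (fun z : X × Ω' => heat P Z (η t z.2) f z.1 * g z.1) (m.prod Q) := by
    have hg1 : Integrable (fun z : X × Ω' => g z.1) (m.prod Q) :=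
      (hg.integrable_of_hasCompactSupport hgc).comp_fst Q
    have := hg1.mul_bdd (c := Bf)
      (hmeas hf).aestronglyMeasurable (Eventually.of_forall fun z => hZ.abs_heat_le hBf _ _)
    simpa only [mul_comm] using this
  simp_rw [hZ.transitionOp_subordinate hη hf.measurable hBf,
    hZ.transitionOp_subordinate hη hg.measurable hBg, ← integral_const_mul, ← integral_mul_const]
  rw [integral_integral_swap (f := fun x ω => f x * heat P Z (η t ω) g x) hif,
    integral_integral_swap (f := fun x ω => heat P Z (η t ω) f x * g x) hig]
  simp_rw [hp.integral_mul_heat_comm hZ hf hfc hg hgc]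

end IsSubGaussianDensity

/-! ### Scaling -/

theorem IsBump.mono {X : Type*} [TopologicalSpace X] [MeasurableSpace X] {m : Measure X}
    {K D D' : Set X} {f : X → ℝ} (h : IsBump m K D f) (hD : D ⊆ D') : IsBump m K D' f :=
  { h with eq_zero := fun x hx => h.eq_zero x fun hx' => hx (hD hx') }

theorem isCompact_closedAnnulus {X : Type*} [MetricSpace X] [ProperSpace X] (x₀ : X) (r R : ℝ) :
    IsCompact (closedAnnulus x₀ r R) := by
  refine Metric.isCompact_of_isClosed_isBounded ?_ ?_
  · exact (isClosed_le continuous_const (continuous_const.dist continuous_id)).inter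
      (isClosed_le (continuous_const.dist continuous_id) continuous_const)
  · refine Metric.isBounded_closedBall (x := x₀) (r := R) |>.subset fun x hx => ?_
    rw [Metric.mem_closedBall, dist_comm]
    exact hx.2

theorem thickening_closedBall_subset {X : Type*} [MetricSpace X] (x₀ : X) {δ r R : ℝ}
    (h : r + δ ≤ R) : Metric.thickening δ (Metric.closedBall x₀ r) ⊆ Metric.ball x₀ R := by
  intro x hx
  obtain ⟨y, hy, hxy⟩ := Metric.mem_thickening_iff.1 hx
  rw [Metric.mem_closedBall] at hy
  rw [Metric.mem_ball]
  linarith [dist_triangle x y x₀]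

theorem thickening_closedAnnulus_subset {X : Type*} [MetricSpace X] (x₀ : X) {δ r p R r' : ℝ}
    (h₁ : r + δ ≤ p) (h₂ : R + δ ≤ r') :
    Metric.thickening δ (closedAnnulus x₀ p R) ⊆ openAnnulus x₀ r r' := by
  intro x hx
  obtain ⟨y, hy, hxy⟩ := Metric.mem_thickening_iff.1 hx
  have h1 := dist_triangle x₀ x y
  have h2 := dist_triangle x₀ y x
  rw [dist_comm y x] at h2
  exact ⟨by linarith [hy.1], by linarith [hy.2]⟩

theorem corollaryA4 {X Ω Ω' : Type*}
    [MetricSpace X] [ProperSpace X] [MeasurableSpace X] [BorelSpace X]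
    [MeasurableSpace Ω] [MeasurableSpace Ω']
    (m : Measure X) (n dw α : ℝ) (hn : 0 < n) (hdw : 2 ≤ dw) (hα : 0 < α) (hαdw : α < dw)
    (hm : IsAhlforsRegular m n)
    (P : Kernel X Ω) (Z : ℝ≥0 → Ω → X) (hZ : IsDiffusion P Z)
    (p : ℝ≥0 → X → X → ℝ) (hp : IsSubGaussianDensity m P Z n dw p)
    (Q : Measure Ω') [IsProbabilityMeasure Q] (η : ℝ≥0 → Ω' → ℝ≥0)
    (hη : IsStableSubordinator Q (α / dw) η)
    (T : ℝ≥0 → (X → ℝ) → X → ℝ)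
    (hT : T = transitionOp (fun x => (P x).prod Q) (subordinate Z η)) :
    IsSymmetricOp m T ∧
      ∃ 𝒟 : Submodule ℝ C₀(X, ℝ), IsUrysohnSpace m T T 𝒟 ∧ HasStableScaling m T T 𝒟 α := by
  subst hT
  have hdw0 : 0 < dw := by linarith
  have hβ : 0 < α / dw := by positivity
  have hβ1 : α / dw < 1 := (div_lt_one hdw0).2 hαdw
  obtain ⟨K, hK⟩ := hp.exists_isBump_thickening hZ (by linarith)
  refine ⟨hp.isSymmetricOp hη.measurable hZ, hZ.lipschitzSpace, ⟨fun f hf => ?_,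
    fun S D hS hD hSD => ?_⟩, ?_⟩
  · exact ⟨hZ.inGeneratorDomain hβ hβ1 hη hf, hZ.inGeneratorDomain hβ hβ1 hη hf⟩
  · obtain ⟨δ, hδ, hsub⟩ := hS.exists_thickening_subset_open hD hSD
    obtain ⟨f, hf, hb, -⟩ := hK S ⟨δ, hδ.le⟩ hS (by exact_mod_cast hδ)
    exact ⟨f, hf, hb.mono hsub⟩
  -- the scale-invariant estimate: `ϱ` is at most of order `δ ^ (-α)` if `D` contains a
  -- `δ`-neighbourhood of the compact set
  have key : ∀ (S D : Set X) (κ R : ℝ), IsCompact S → 0 < κ → 0 < R →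
      Metric.thickening (κ * R) S ⊆ D →
      urysohnRho m (transitionOp (fun x => (P x).prod Q) (subordinate Z η))
        (transitionOp (fun x => (P x).prod Q) (subordinate Z η)) hZ.lipschitzSpace S D
        ≤ ((2 * (K : ℝ) ^ (α / dw) * κ ^ (-α) * R ^ (-α) : ℝ) : EReal) := by
    intro S D κ R hS hκ hR hsub
    have hδ : 0 < κ * R := mul_pos hκ hR
    obtain ⟨δ, hδe⟩ : ∃ δ : ℝ≥0, (δ : ℝ) = κ * R := ⟨_, Real.coe_toNNReal _ hδ.le⟩
    rw [← hδe] at hδ hsub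
    obtain ⟨f, hf, hb, hL⟩ := hK S δ hS (by exact_mod_cast hδ)
    refine iInf_le_of_le f (iInf_le_of_le hf (iInf_le_of_le (hb.mono hsub) (iSup_le fun x => ?_)))
    rw [max_self, EReal.coe_le_coe_iff]
    refine (le_abs_self _).trans ((hZ.abs_generator_le hβ hβ1 hη f.continuous.measurable
      hb.nonneg hb.le_one hL x).trans_eq ?_)
    push_cast
    rw [Real.div_rpow K.coe_nonneg (by positivity), ← Real.rpow_mul hδ.le,
      mul_div_cancel₀ α hdw0.ne', mul_assoc _ (κ ^ (-α)), ← Real.mul_rpow hκ.le hR.le, ← hδe,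
      Real.rpow_neg hδ.le]
    ring
  constructor
  · refine ⟨fun a => 2 * (K : ℝ) ^ (α / dw) * (1 - a) ^ (-α), fun x₀ r R hr hrR => ?_⟩
    have hR : 0 < R := hr.trans hrR
    refine key _ _ _ R (isCompact_closedBall x₀ r) (sub_pos.2 ((div_lt_one hR).2 hrR)) hR
      (thickening_closedBall_subset x₀ ?_)
    rw [sub_mul, div_mul_cancel₀ _ hR.ne']
    linarith
  · refine ⟨fun a b c => 2 * (K : ℝ) ^ (α / dw) * (min (b - a) (c⁻¹ - 1)) ^ (-α),
      fun x₀ r p R r' hr hrp hpR hRr => ?_⟩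
    have hR : 0 < R := hr.trans (hrp.trans hpR)
    have e1 : (p / R - r / R) * R = p - r := by field_simp
    have e2 : ((R / r')⁻¹ - 1) * R = r' - R := by
      rw [inv_div]; field_simp
    refine key _ _ _ R (isCompact_closedAnnulus x₀ p R) (lt_min ?_ ?_) hR
      (thickening_closedAnnulus_subset x₀ ?_ ?_)
    · rw [← sub_div]
      exact div_pos (by linarith) hR
    · rw [inv_div, sub_pos, one_lt_div hR]
      exact hRr
    · have := mul_le_mul_of_nonneg_right (min_le_left (p / R - r / R) ((R / r')⁻¹ - 1)) hR.le
      linarith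
    · have := mul_le_mul_of_nonneg_right (min_le_right (p / R - r / R) ((R / r')⁻¹ - 1)) hR.le
      linarith
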